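/- \textbf{Setting.} Let $\Omega\subset\{1,\dots,k\}^{\mathbb Z}$ be an infinite subshift of finite type given by a transition relation on symbols, $\sigma$ the left shift, $\rho>1$, and $d_\Omega(x,y)=\rho^{-N}$ with $N=\max\{N\ge 0: x_n=y_n \text{ for all } |n|<N\}$ (and $d_\Omega(x,x)=0$). Let $W^s_{loc}(x)=\{y: y_n=x_n\ \forall n\ge 0\}$, $W^u_{loc}(x)=\{y: y_n=x_n\ \forall n\le 0\}$. Let $S^1=\mathbb R/\mathbb Z$ with the arc-length distance $d$, and $\alpha,\beta\in(0,1]$. Let $\mathcal H_\beta(S^1)$ be the set of homeomorphisms of $S^1$ that are $\beta$-H\"older together with their inverse, with $d_{\max}(e_1,e_2)=\max\{d_\beta(e_1,e_2),d_\beta(e_1^{-1},e_2^{-1})\}$ and $d_\beta(e_1,e_2)=\sup_p d(e_1(p),e_2(p))+|H_\beta(e_1)-H_\beta(e_2)|$, where $H_\beta$ is the H\"older constant. Let $\mathcal H_\alpha(\Omega,\mathcal H_\beta(S^1))$ be the set of $\alpha$-H\"older maps $f\colon(\Omega,d_\Omega)\to(\mathcal H_\beta(S^1),d_{\max})$, with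 $d_\alpha(f,g)=\sup_x d_{\max}(f_x,g_x)+|H_\alpha(f)-H_\alpha(g)|$. Put $F_f(x,p)=(\sigma(x),f_x(p))$ and $f^n_x=f_{\sigma^{n-1}(x)}\circ\dots\circ f_x$. A \emph{stable holonomy} of $F_f$ is a family of homeomorphisms $h^s_{x,y}\colon S^1\to S^1$, $y\in W^s_{loc}(x)$, which are H\"older with uniform exponent and constant and satisfy $h^s_{y,z}\circ h^s_{x,y}=h^s_{x,z}$, $h^s_{x,x}=\mathrm{Id}$; $h^s_{\sigma(x),\sigma(y)}=f_y\circ h^s_{x,y}\circ f_x^{-1}$; $(x,y)\mapsto h^s_{x,y}$ is continuous in the $C^0$ sense; and $h^s_{x,y}=\lim_{n\to\infty}(f^n_y)^{-1}\circ f^n_x$ pointwise. (It is unique if it exists.) An \emph{unstable holonomy} $h^u$ is defined analogously on local unstable sets, for the inverse cocycle. An \emph{su-state} of $F_f$ over a $\sigma$-invariant probability $\mu$ is an $F_f$-invariant probability measure $m$ projecting to $\mu$ which has a disintegration $(m_x)$ along the fibers $\{x\}\times S^1$ such that, for points $x,y$ in a set of full $\mu$-measure, $m_y=(h^s_{x,y})_*m_x$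 if $y\in W^s_{loc}(x)$ and $m_y=(h^u_{x,y})_*m_x$ if $y\in W^u_{loc}(x)$. Thus $F_f$ admits an su-state only if it has both holonomies. \textbf{Proposition.} Let $f\in\mathcal H_\alpha(\Omega,\mathcal H_\beta(S^1))$ and let $\mu$ be a $\sigma$-invariant probability measure such that: (a) $\mu$ is ergodic, fully supported and has local product structure: there is a continuous $D\colon\Omega\to(0,\infty)$ such that $\mu(E)=\int (\chi_E\circ\psi_i)\,(D\circ\psi_i)\,d(\mu^u\times\mu^s)$ for every symbol $i$ and every measurable $E\subset[0;i]=\{x: x_0=i\}$, where $\mu^s=P^s_*\mu$ and $\mu^u=P^u_*\mu$ are the images of $\mu$ under the projections $P^s$, $P^u$ to the coordinates $n\ge 0$, $n\le 0$, and $\psi_i\colon P^u([0;i])\times P^s([0;i])\to[0;i]$ joins a past and a future; (b) $F_f$ is pinching: there is a periodic point $x_0$ of $\sigma$, of minimal period $q$, such that $\varphi=f^{q}_{x_0}$ has exactly two fixed points, an attractor $a$ and a repeller $r$, in the sense that $\varphi^n(p)\to a$ for all $p\ne r$ and $\varphi^{-n}(p)\to r$ for all $p\neq a$; (c) $F_f$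 is su-dominated: there is $c<1$ such that $H_\beta(f_*)\,\rho^{-\alpha\beta}\le c$ for all fiber maps $f_*$ of $F_f$ and of $F_f^{-1}$. Then for every $\varepsilon>0$ there exists $g\in\mathcal H_\alpha(\Omega,\mathcal H_\beta(S^1))$ with $d_\alpha(f,g)<\varepsilon$ such that $F_g$ does not admit su-states. Moreover, if $\beta=1$, then $g$ can be chosen so that, in addition, $F_g$ has a stable and an unstable holonomy. -/

import Mathlib

open MeasureTheory ProbabilityTheory Filter Topology
open scoped ENNReal

noncomputable section

/-- The circle `ℝ / ℤ` with its arc-length distance. -/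
abbrev S1 : Type := UnitAddCircle

/-! ### Subshifts of finite type -/

/-- The two-sided subshift of finite type on the alphabet `Fin k` with transition relation `A`,
with the topology and the Borel structure of the product. -/
def SFT {k : ℕ} (A : Fin k → Fin k → Prop) : Set (ℤ → Fin k) :=
  {x | ∀ n : ℤ, A (x n) (x (n + 1))}

/-- The left shift. -/
def shift {k : ℕ} (A : Fin k → Fin k → Prop) : SFT A ≃ SFT A where
  toFun x := ⟨fun n => x.1 (n + 1), fun n => x.2 (n + 1)⟩
  invFun x := ⟨fun n => x.1 (n - 1), fun n => by
    have h := x.2 (n - 1)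
    rw [show n - 1 + 1 = n + 1 - 1 by ring] at h
    exact h⟩
  left_inv x := by ext n; simp
  right_inv x := by ext n; simp

/-- The distance `ρ ^ (-N)`, where `N` is the largest integer such that `x n = y n` for all
`|n| < N` (and the distance is `0` if `x = y`). -/
def shiftDist {k : ℕ} {A : Fin k → Fin k → Prop} (ρ : ℝ) (x y : SFT A) : ℝ :=
  open Classical in
  if x = y then 0
  else ρ ^ (-((sSup {N : ℕ | ∀ n : ℤ, |n| < (N : ℤ) → x.1 n = y.1 n} : ℕ) : ℝ))

/-- The local stable set of `x`: same coordinates at all times `n ≥ 0`. -/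
def localStable {k : ℕ} {A : Fin k → Fin k → Prop} (x : SFT A) : Set (SFT A) :=
  {y | ∀ n : ℤ, 0 ≤ n → y.1 n = x.1 n}

/-- The local unstable set of `x`: same coordinates at all times `n ≤ 0`. -/
def localUnstable {k : ℕ} {A : Fin k → Fin k → Prop} (x : SFT A) : Set (SFT A) :=
  {y | ∀ n : ℤ, n ≤ 0 → y.1 n = x.1 n}

/-! ### Local product structure -/

/-- The projection `P^s` onto the coordinates `n ≥ 0`. -/
def projS {k : ℕ} {A : Fin k → Fin k → Prop} (x : SFT A) : ℕ → Fin k :=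
  fun n => x.1 (n : ℤ)

/-- The projection `P^u` onto the coordinates `n ≤ 0`; entry `n` is the coordinate `-n`. -/
def projU {k : ℕ} {A : Fin k → Fin k → Prop} (x : SFT A) : ℕ → Fin k :=
  fun n => x.1 (-(n : ℤ))

/-- The cylinder `[0; i]`. -/
def cylinder {k : ℕ} (A : Fin k → Fin k → Prop) (i : Fin k) : Set (SFT A) :=
  {x | x.1 0 = i}

/-- The map `ψ` that joins a past and a future. It sends `P^u [0; i] × P^s [0; i]` to `[0; i]`,
see `glue_projU_projS`. -/
def glue {k : ℕ} (q : (ℕ → Fin k) × (ℕ → Fin k)) : ℤ → Fin k :=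
  fun n => if 0 ≤ n then q.2 n.toNat else q.1 (-n).toNat

theorem glue_projU_projS {k : ℕ} {A : Fin k → Fin k → Prop} {i : Fin k} {x y : SFT A}
    (hx : x ∈ cylinder A i) (hy : y ∈ cylinder A i) :
    glue (projU x, projS y) ∈ SFT A ∧ glue (projU x, projS y) 0 = i := by
  have hx' : x.1 0 = i := hx
  have hy' : y.1 0 = i := hy
  have key : ∀ n : ℤ, glue (projU x, projS y) n = if 0 ≤ n then y.1 n else x.1 n := by
    intro n
    unfold glue projU projS
    split_ifs with h
    · simp [Int.toNat_of_nonneg h]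
    · have : ((-n).toNat : ℤ) = -n := Int.toNat_of_nonneg (by omega)
      simp only [this, neg_neg]
  refine ⟨fun n => ?_, by rw [key]; simpa using hy'⟩
  rw [key, key]
  by_cases h : 0 ≤ n
  · rw [if_pos h, if_pos (by omega)]
    exact y.2 n
  · rw [if_neg h]
    by_cases h1 : 0 ≤ n + 1
    · rw [if_pos h1]
      have h0 : n + 1 = 0 := by omega
      have h2 := x.2 n
      rw [h0, hx'] at h2
      rw [h0, hy']
      exact h2
    · rw [if_neg h1]
      exact x.2 n

/-- Local product structure: there is a continuous `D : Ω → (0, ∞)` such that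
`μ E = ∫ (χ_E ∘ ψ) (D ∘ ψ) d(μ^u × μ^s)` for every `i` and every measurable `E ⊆ [0; i]`, where
`μ^u`, `μ^s` are the images of `μ` under `P^u`, `P^s` and the integral is over
`P^u [0; i] × P^s [0; i]`. -/
def HasLocalProductStructure {k : ℕ} {A : Fin k → Fin k → Prop} (μ : Measure (SFT A)) : Prop :=
  ∃ D : (ℤ → Fin k) → ℝ, ContinuousOn D (SFT A) ∧ (∀ z ∈ SFT A, 0 < D z) ∧
    ∀ (i : Fin k) (E : Set (SFT A)), MeasurableSet E → E ⊆ cylinder A i →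
      μ E = ∫⁻ q in (projU '' cylinder A i) ×ˢ (projS '' cylinder A i),
        (Subtype.val '' E).indicator (fun z => ENNReal.ofReal (D z)) (glue q)
          ∂((μ.map projU).prod (μ.map projS))

/-! ### Hölder maps and the spaces of cocycles -/

/-- `f` is Hölder of exponent `a` with respect to the distances `dX`, `dY`. -/
def IsHolder {X Y : Type*} (dX : X → X → ℝ) (dY : Y → Y → ℝ) (a : ℝ) (f : X → Y) : Prop :=
  ∃ C : ℝ, ∀ x y, dY (f x) (f y) ≤ C * dX x y ^ a

/-- The Hölder constant of `f`: the least admissible constant. -/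
def holderConst {X Y : Type*} (dX : X → X → ℝ) (dY : Y → Y → ℝ) (a : ℝ) (f : X → Y) : ℝ :=
  sInf {C : ℝ | 0 ≤ C ∧ ∀ x y, dY (f x) (f y) ≤ C * dX x y ^ a}

/-- Homeomorphisms of the circle that are `β`-Hölder together with their inverse. -/
structure BiHolder (β : ℝ) where
  homeo : S1 ≃ₜ S1
  holder : IsHolder dist dist β homeo
  holder_symm : IsHolder dist dist β homeo.symm

/-- `d_β (e₁, e₂) = sup_p d (e₁ p, e₂ p) + |H_β (e₁) - H_β (e₂)|`. -/
def dBeta (β : ℝ) (e₁ e₂ : S1 ≃ₜ S1) : ℝ :=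
  (⨆ p : S1, dist (e₁ p) (e₂ p)) + |holderConst dist dist β e₁ - holderConst dist dist β e₂|

/-- `d_max (e₁, e₂) = max (d_β (e₁, e₂)) (d_β (e₁⁻¹, e₂⁻¹))`. -/
def dMax {β : ℝ} (e₁ e₂ : BiHolder β) : ℝ :=
  max (dBeta β e₁.homeo e₂.homeo) (dBeta β e₁.homeo.symm e₂.homeo.symm)

/-- The `α`-Hölder maps from `(Ω, d_Ω)` to the bi-`β`-Hölder homeomorphisms with `d_max`. -/
structure HolderCocycle {k : ℕ} (A : Fin k → Fin k → Prop) (ρ α β : ℝ) where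
  fiber : SFT A → BiHolder β
  holder : IsHolder (shiftDist ρ) dMax α fiber

section Cocycles

variable {k : ℕ} {A : Fin k → Fin k → Prop} {ρ α β : ℝ}

/-- `d_α (f, g) = sup_x d_max (f_x, g_x) + |H_α (f) - H_α (g)|`. -/
def dAlpha (f g : HolderCocycle A ρ α β) : ℝ :=
  (⨆ x : SFT A, dMax (f.fiber x) (g.fiber x)) +
    |holderConst (shiftDist ρ) dMax α f.fiber - holderConst (shiftDist ρ) dMax α g.fiber|

/-- The fiber map `f_x`. -/
def HolderCocycle.map (f : HolderCocycle A ρ α β) (x : SFT A) : S1 ≃ₜ S1 :=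
  (f.fiber x).homeo

/-- The skew product `F_f (x, p) = (σ x, f_x p)`. -/
def HolderCocycle.skew (f : HolderCocycle A ρ α β) (q : SFT A × S1) : SFT A × S1 :=
  (shift A q.1, f.map q.1 q.2)

/-- The iterate `f^n_x = f_{σ^(n-1) x} ∘ ⋯ ∘ f_x`. -/
def HolderCocycle.iter (f : HolderCocycle A ρ α β) : ℕ → SFT A → (S1 ≃ₜ S1)
  | 0, _ => Homeomorph.refl S1
  | n + 1, x => (f.iter n x).trans (f.map ((shift A)^[n] x))

/-! ### Pinching and domination -/

/-- `φ` has exactly two fixed points, the attractor `a` and the repeller `r`: all points other than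
`r` converge to `a` in the future, all points other than `a` converge to `r` in the past. -/
structure IsAttractorRepeller (φ : S1 ≃ₜ S1) (a r : S1) : Prop where
  ne : a ≠ r
  fixed : ∀ p, φ p = p ↔ p = a ∨ p = r
  attracting : ∀ p, p ≠ r → Tendsto (fun n : ℕ => φ^[n] p) atTop (𝓝 a)
  repelling : ∀ p, p ≠ a → Tendsto (fun n : ℕ => φ.symm^[n] p) atTop (𝓝 r)

/-- Pinching: for some periodic point `x₀` of `σ` the map `f^per_{x₀}` over the period of `x₀` has
exactly two fixed points, one attractor and one repeller. -/
def HolderCocycle.IsPinching (f : HolderCocycle A ρ α β) : Prop :=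
  ∃ x₀ ∈ Function.periodicPts (shift A), ∃ a r : S1,
    IsAttractorRepeller (f.iter (Function.minimalPeriod (shift A) x₀) x₀) a r

/-- su-domination: `H_β (f_*) ρ^(-αβ) ≤ c < 1` for all fiber maps `f_*` of `F_f` and of its
inverse. -/
def HolderCocycle.IsSUDominated (f : HolderCocycle A ρ α β) : Prop :=
  ∃ c : ℝ, c < 1 ∧ ∀ x : SFT A,
    holderConst dist dist β (f.map x) * ρ ^ (-(α * β)) ≤ c ∧
    holderConst dist dist β (f.map x).symm * ρ ^ (-(α * β)) ≤ c

/-! ### Holonomies and su-states -/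

/-- `h` is the stable holonomy of the cocycle `f`: a family of uniformly Hölder homeomorphisms
`h x y`, relevant for `y` in the local stable set of `x`, that is compatible with composition and
with the dynamics, is continuous in `(x, y)` (in the `C⁰` sense), and is the family given by the
graph transform, `h x y = lim (f^n_y)⁻¹ ∘ f^n_x`. The last property makes `h` unique on pairs in
the same local stable set. -/
structure IsStableHolonomy (f : HolderCocycle A ρ α β) (h : SFT A → SFT A → (S1 ≃ₜ S1)) :
    Prop where
  refl : ∀ x p, h x x p = p
  comp : ∀ x y z, y ∈ localStable x → z ∈ localStable x → ∀ p, h y z (h x y p) = h x z p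
  equivariant : ∀ x y, y ∈ localStable x → ∀ p,
    h (shift A x) (shift A y) p = f.map y (h x y ((f.map x).symm p))
  continuousOn : ContinuousOn (fun q : (SFT A × SFT A) × S1 => h q.1.1 q.1.2 q.2)
    {q | q.1.2 ∈ localStable q.1.1}
  holder : ∃ C γ : ℝ, 0 < γ ∧ ∀ x y, y ∈ localStable x → ∀ p q,
    dist (h x y p) (h x y q) ≤ C * dist p q ^ γ
  limit : ∀ x y, y ∈ localStable x → ∀ p,
    Tendsto (fun n : ℕ => (f.iter n y).symm (f.iter n x p)) atTop (𝓝 (h x y p))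

/-- `h` is the unstable holonomy of the cocycle `f`: the same notion for the inverse cocycle and
the local unstable sets, with `h x y = lim f^n_{σ^(-n) y} ∘ (f^n_{σ^(-n) x})⁻¹`. -/
structure IsUnstableHolonomy (f : HolderCocycle A ρ α β) (h : SFT A → SFT A → (S1 ≃ₜ S1)) :
    Prop where
  refl : ∀ x p, h x x p = p
  comp : ∀ x y z, y ∈ localUnstable x → z ∈ localUnstable x → ∀ p, h y z (h x y p) = h x z p
  equivariant : ∀ x y, y ∈ localUnstable x → ∀ p,
    h ((shift A).symm x) ((shift A).symm y) p =
      (f.map ((shift A).symm y)).symm (h x y (f.map ((shift A).symm x) p))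
  continuousOn : ContinuousOn (fun q : (SFT A × SFT A) × S1 => h q.1.1 q.1.2 q.2)
    {q | q.1.2 ∈ localUnstable q.1.1}
  holder : ∃ C γ : ℝ, 0 < γ ∧ ∀ x y, y ∈ localUnstable x → ∀ p q,
    dist (h x y p) (h x y q) ≤ C * dist p q ^ γ
  limit : ∀ x y, y ∈ localUnstable x → ∀ p,
    Tendsto (fun n : ℕ => f.iter n ((shift A).symm^[n] y)
      ((f.iter n ((shift A).symm^[n] x)).symm p)) atTop (𝓝 (h x y p))

/-- The family `κ` of measures on the fibers is invariant under `h` along the local sets `W`, for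
points in a set of full `μ`-measure. -/
def IsHolonomyInvariant (μ : Measure (SFT A)) (W : SFT A → Set (SFT A))
    (h : SFT A → SFT A → (S1 ≃ₜ S1)) (κ : Kernel (SFT A) S1) : Prop :=
  ∃ E : Set (SFT A), MeasurableSet E ∧ μ Eᶜ = 0 ∧
    ∀ x ∈ E, ∀ y ∈ E, y ∈ W x → κ y = (κ x).map (h x y)

/-- `m` is an `F_f`-invariant probability measure that projects to `μ` and has a disintegration
`κ` along the fibers `{x} × S¹` which is both s-invariant and u-invariant, for the stable holonomy
`hs` and the unstable holonomy `hu`. -/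
structure IsSUState (μ : Measure (SFT A)) (f : HolderCocycle A ρ α β)
    (hs hu : SFT A → SFT A → (S1 ≃ₜ S1)) (m : Measure (SFT A × S1)) : Prop where
  prob : IsProbabilityMeasure m
  invariant : MeasurePreserving f.skew m m
  proj : m.map Prod.fst = μ
  disintegration : ∃ κ : Kernel (SFT A) S1, IsMarkovKernel κ ∧ μ ⊗ₘ κ = m ∧
    IsHolonomyInvariant μ localStable hs κ ∧ IsHolonomyInvariant μ localUnstable hu κ

/-- `F_f` has a stable and an unstable holonomy. -/
def HolderCocycle.HasHolonomies (f : HolderCocycle A ρ α β) : Prop :=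
  (∃ hs, IsStableHolonomy f hs) ∧ ∃ hu, IsUnstableHolonomy f hu

/-- `F_f` admits an su-state over `μ`. -/
def HolderCocycle.AdmitsSUState (f : HolderCocycle A ρ α β) (μ : Measure (SFT A)) : Prop :=
  ∃ hs hu, IsStableHolonomy f hs ∧ IsUnstableHolonomy f hu ∧ ∃ m, IsSUState μ f hs hu m

end Cocycles

end

/-!
The perturbation `g` is `f` with the fiber maps over one small window rotated by a small angle `t`.
Rotations are isometries of the circle, so no Hölder constant of a fiber map or of its inverse
changes; since points on different sides of a window are a definite distance apart, `g` is close
to `f` in `dAlpha` when `t` is small (`eventually_dAlpha_rotateOn_lt`), and `g` is su-dominated with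
the same constant. For `β = 1` domination gives the holonomies of `g` as uniform limits of graph
transforms (`HolderCocycle.IsSUDominated.hasHolonomies`).

The window is chosen around a point `z` homoclinic to the pinching periodic point `x₀`. Ergodicity
and full support provide paths between any two symbols, and since the subshift is infinite, `z` can
be made to pass through a word that `x₀` does not contain (`exists_homoclinic`). A small enough
window around `z` contains no point of the orbit of `x₀` and no other point of the orbit of `z`
(`exists_isolating_window`).

Suppose that `g` has an su-state over `μ`. By local product structure almost every bracket of two
points is a typical point, so on the cylinder of `x₀` the disintegration of the su-state is almost
everywhere the image of one measure `κ b` under the transport along an unstable and then a stable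
holonomy, which depends continuously on the point. By full support this continuous version is
invariant under the holonomies and under the cocycle at every point, in particular at `x₀` and along
the orbit of `z`. Hence the conditional measure over `x₀` is invariant under the return map `φ` and
under the loop `H` that goes from `x₀` to `z` by unstable holonomy, follows the orbit of `z`, and
comes back to `x₀` by stable holonomy (`IsSUState.exists_invariant_measure`). A `φ`-invariant
probability measure lives on the attractor and the repeller, so `H` maps one of these two points to
one of them (`IsAttractorRepeller.exists_mem_of_map_eq`).

The two holonomies in `H` are limits that involve the fiber maps outside the window only, so they do
not depend on `t`; the rotation enters `H` once, at `z`. Therefore at most four angles `t` allow an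
su-state (`finite_setOf_admitsSUState`), and arbitrarily small angles remain.
-/

/-! ### The shift and its distance -/

section Subshift

variable {k : ℕ} {A : Fin k → Fin k → Prop} {ρ : ℝ}

theorem shift_apply (x : SFT A) (n : ℤ) : (shift A x).1 n = x.1 (n + 1) := rfl

theorem shift_symm_apply (x : SFT A) (n : ℤ) : ((shift A).symm x).1 n = x.1 (n - 1) := rfl

theorem shift_iterate_apply (m : ℕ) (x : SFT A) (n : ℤ) :
    ((shift A)^[m] x).1 n = x.1 (n + m) := by
  induction m generalizing x n with
  | zero => simp
  | succ m ih =>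
    rw [Function.iterate_succ_apply', shift_apply, ih]
    exact congrArg x.1 (by push_cast; ring)

theorem shift_symm_iterate_apply (m : ℕ) (x : SFT A) (n : ℤ) :
    ((shift A).symm^[m] x).1 n = x.1 (n - m) := by
  induction m generalizing x n with
  | zero => simp
  | succ m ih =>
    rw [Function.iterate_succ_apply', shift_symm_apply, ih]
    exact congrArg x.1 (by push_cast; ring)

theorem continuous_coord (n : ℤ) : Continuous fun x : SFT A => x.1 n :=
  (continuous_apply n).comp continuous_subtype_val

theorem continuous_shift : Continuous (shift A) :=
  Continuous.subtype_mk (continuous_pi fun n => continuous_coord (n + 1)) _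

theorem continuous_shift_symm : Continuous (shift A).symm :=
  Continuous.subtype_mk (continuous_pi fun n => continuous_coord (n - 1)) _

theorem isOpen_coord_eq (n : ℤ) (i : Fin k) : IsOpen {x : SFT A | x.1 n = i} :=
  (isOpen_discrete {i}).preimage (continuous_coord n)

theorem isOpen_cylinder (i : Fin k) : IsOpen (cylinder A i) := isOpen_coord_eq 0 i

theorem bddAbove_agree {x y : SFT A} {m : ℤ} (h : x.1 m ≠ y.1 m) :
    ∀ N ∈ {N : ℕ | ∀ n : ℤ, |n| < (N : ℤ) → x.1 n = y.1 n}, N ≤ m.natAbs := by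
  intro N hN
  by_contra hlt
  exact h (hN m (by rw [Int.abs_eq_natAbs]; exact_mod_cast not_le.mp hlt))

theorem exists_coord_ne {x y : SFT A} (h : x ≠ y) : ∃ m, x.1 m ≠ y.1 m := by
  by_contra! hc
  exact h (Subtype.ext (funext hc))

theorem shiftDist_nonneg (hρ : 1 < ρ) (x y : SFT A) : 0 ≤ shiftDist ρ x y := by
  unfold shiftDist
  split_ifs
  · exact le_rfl
  · positivity

theorem shiftDist_le (hρ : 1 < ρ) {x y : SFT A} {N : ℕ}
    (h : ∀ n : ℤ, |n| < (N : ℤ) → x.1 n = y.1 n) : shiftDist ρ x y ≤ ρ ^ (-(N : ℝ)) := by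
  unfold shiftDist
  split_ifs with hxy
  · positivity
  · obtain ⟨m, hm⟩ := exists_coord_ne hxy
    refine Real.rpow_le_rpow_of_exponent_le hρ.le (neg_le_neg ?_)
    exact_mod_cast le_csSup ⟨_, bddAbove_agree hm⟩ h

theorem le_shiftDist (hρ : 1 < ρ) {x y : SFT A} {M : ℕ} {m : ℤ} (hm : m.natAbs ≤ M)
    (h : x.1 m ≠ y.1 m) : ρ ^ (-(M : ℝ)) ≤ shiftDist ρ x y := by
  unfold shiftDist
  rw [if_neg (fun hxy => h (by rw [hxy]))]
  refine Real.rpow_le_rpow_of_exponent_le hρ.le (neg_le_neg ?_)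
  exact_mod_cast (csSup_le' (bddAbove_agree h)).trans hm

theorem tendsto_rpow_neg_nat (hρ : 1 < ρ) {a : ℝ} (ha : 0 < a) :
    Tendsto (fun N : ℕ => (ρ ^ (-(N : ℝ))) ^ a) atTop (𝓝 0) := by
  have h : ∀ N : ℕ, (ρ ^ (-(N : ℝ))) ^ a = (ρ ^ (-a)) ^ N := fun N => by
    rw [← Real.rpow_mul (by linarith), ← Real.rpow_natCast, ← Real.rpow_mul (by linarith)]
    congr 1
    ring
  simp only [h]
  exact tendsto_pow_atTop_nhds_zero_of_lt_one (by positivity)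
    (Real.rpow_lt_one_of_one_lt_of_neg hρ (by linarith))

theorem eventually_agree (x : SFT A) (N : ℕ) :
    ∀ᶠ y in 𝓝 x, ∀ n : ℤ, |n| < (N : ℤ) → x.1 n = y.1 n := by
  have : ∀ᶠ y : SFT A in 𝓝 x, ∀ n ∈ Finset.Ioo (-(N : ℤ)) N, y.1 n = x.1 n :=
    (Finset.eventually_all _).2 fun n _ => (isOpen_coord_eq n (x.1 n)).mem_nhds rfl
  filter_upwards [this] with y hy n hn
  exact (hy n (Finset.mem_Ioo.2 (abs_lt.1 hn))).symm

theorem tendsto_shiftDist_rpow (hρ : 1 < ρ) {a : ℝ} (ha : 0 < a) (x : SFT A) :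
    Tendsto (fun y => shiftDist ρ x y ^ a) (𝓝 x) (𝓝 0) := by
  rw [Metric.tendsto_nhds]
  intro ε hε
  obtain ⟨N, hN⟩ := ((tendsto_rpow_neg_nat hρ ha).eventually_lt_const hε).exists
  filter_upwards [eventually_agree x N] with y hy
  rw [Real.dist_0_eq_abs, abs_of_nonneg (Real.rpow_nonneg (shiftDist_nonneg hρ _ _) _)]
  exact (Real.rpow_le_rpow (shiftDist_nonneg hρ _ _) (shiftDist_le hρ hy) ha.le).trans_lt hN

/-! ### Homoclinic points -/

/-- An ergodic fully supported measure makes every nonempty open set reach every other one. -/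
theorem exists_iterate_mem_of_ergodic {X : Type*} [TopologicalSpace X] [MeasurableSpace X]
    [OpensMeasurableSpace X] {T : X → X} (hT : Continuous T) {μ : Measure X} [IsFiniteMeasure μ]
    [μ.IsOpenPosMeasure] (herg : Ergodic T μ) {U V : Set X} (hU : IsOpen U) (hU' : U.Nonempty)
    (hV : IsOpen V) (hV' : V.Nonempty) : ∃ n : ℕ, ∃ x ∈ U, T^[n] x ∈ V := by
  have hB : IsOpen (⋃ n : ℕ, T^[n] ⁻¹' V) := isOpen_iUnion fun n => hV.preimage (hT.iterate n)
  have hVB : V ⊆ ⋃ n : ℕ, T^[n] ⁻¹' V := fun x hx => Set.mem_iUnion.2 ⟨0, hx⟩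
  have hsub : T ⁻¹' (⋃ n : ℕ, T^[n] ⁻¹' V) ⊆ ⋃ n : ℕ, T^[n] ⁻¹' V := by
    intro x hx
    obtain ⟨n, hn⟩ := Set.mem_iUnion.1 hx
    exact Set.mem_iUnion.2 ⟨n + 1, hn⟩
  rcases herg.ae_empty_or_univ_of_preimage_ae_le hB.measurableSet.nullMeasurableSet
    hsub.eventuallyLE with h | h
  · exact absurd (measure_mono_null hVB (ae_eq_empty.1 h)) (hV.measure_pos μ hV').ne'
  · by_contra! hc
    have hUB : U ⊆ (⋃ n : ℕ, T^[n] ⁻¹' V)ᶜ := by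
      intro x hx hx'
      obtain ⟨n, hn⟩ := Set.mem_iUnion.1 hx'
      exact hc n x hx hn
    exact (hU.measure_pos μ hU').ne' (measure_mono_null hUB (ae_eq_univ.1 h))

/-- Follow `x` before time `m` and then `y` from its time `0` on. -/
theorem exists_concat (x y : SFT A) (m : ℤ) (h : x.1 m = y.1 0) :
    ∃ w : SFT A, (∀ n < m, w.1 n = x.1 n) ∧ ∀ n, m ≤ n → w.1 n = y.1 (n - m) := by
  refine ⟨⟨fun n => if n < m then x.1 n else y.1 (n - m), fun n => ?_⟩, fun n hn => if_pos hn,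
    fun n hn => if_neg (not_lt.2 hn)⟩
  rcases lt_trichotomy (n + 1) m with h1 | h1 | h1
  · simp only [if_pos h1, if_pos (show n < m by omega)]
    exact x.2 n
  · have h2 := x.2 n
    subst h1
    rw [h] at h2
    simpa using h2
  · simp only [if_neg (show ¬ n + 1 < m by omega), if_neg (show ¬ n < m by omega)]
    have h2 := y.2 (n - m)
    rwa [show n - m + 1 = n + 1 - m by ring] at h2

theorem coord_add_mul {x₀ : SFT A} {q : ℤ} (hx₀ : ∀ n : ℤ, x₀.1 (n + q) = x₀.1 n) (c n : ℤ) :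
    x₀.1 (n + c * q) = x₀.1 n := by
  induction c using Int.induction_on generalizing n with
  | zero => simp
  | succ c ih => exact (congrArg x₀.1 (by ring)).trans ((hx₀ (n + c * q)).trans (ih n))
  | pred c ih =>
    exact ((hx₀ _).symm.trans (congrArg x₀.1 (by ring))).trans (ih n)

theorem coord_add_emod {x₀ : SFT A} {q : ℤ} (hx₀ : ∀ n : ℤ, x₀.1 (n + q) = x₀.1 n) (j n : ℤ) :
    x₀.1 (n + j) = x₀.1 (n + j % q) := by
  rw [← coord_add_mul hx₀ (j / q) (n + j % q), add_assoc, mul_comm, Int.emod_add_mul_ediv]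

/-- The finitely many points of a periodic orbit differ from a given other point within a window. -/
theorem exists_window_orbit {x₀ z : SFT A} {q : ℕ} (hq : 0 < q)
    (hx₀ : ∀ n : ℤ, x₀.1 (n + q) = x₀.1 n) (hz : ∀ j : ℕ, ∃ n : ℤ, x₀.1 (n + j) ≠ z.1 n) :
    ∃ M : ℕ, ∀ j : ℤ, ∃ n : ℤ, n.natAbs ≤ M ∧ x₀.1 (n + j) ≠ z.1 n := by
  choose ν hν using hz
  refine ⟨(Finset.range q).sup fun j => (ν j).natAbs, fun j => ?_⟩
  have h0 : 0 ≤ j % q := Int.emod_nonneg _ (by omega)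
  have h1 : j % q < q := Int.emod_lt_of_pos _ (by omega)
  obtain ⟨c, hc⟩ := Int.eq_ofNat_of_zero_le h0
  refine ⟨ν c, Finset.le_sup (f := fun j => (ν j).natAbs) (Finset.mem_range.2 (by omega)), ?_⟩
  rw [coord_add_emod hx₀, hc]
  exact hν c

/-- Some finite word of the subshift, here `w.1 0, …, w.1 (L - 1)`, does not occur in the periodic
sequence `x₀`. -/
theorem exists_word_not_in_orbit (hinf : Infinite (SFT A)) {x₀ : SFT A} {q : ℕ} (hq : 0 < q)
    (hx₀ : ∀ n : ℤ, x₀.1 (n + q) = x₀.1 n) :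
    ∃ (w : SFT A) (L : ℕ), ∀ j : ℤ, ∃ n : ℤ, 0 ≤ n ∧ n < L ∧ x₀.1 (n + j) ≠ w.1 n := by
  obtain ⟨w, hw⟩ :=
    (Set.finite_range fun j : Fin q => (shift A)^[(j : ℕ)] x₀).infinite_compl.nonempty
  obtain ⟨M, hM⟩ := exists_window_orbit hq hx₀ (z := w) fun j => by
    by_contra! hc
    refine hw ⟨⟨j % q, Nat.mod_lt _ hq⟩, Subtype.ext (funext fun n => ?_)⟩
    rw [shift_iterate_apply, ← hc n, coord_add_emod hx₀ j n]
    exact congrArg x₀.1 (by simp)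
  refine ⟨(shift A).symm^[M] w, 2 * M + 1, fun j => ?_⟩
  obtain ⟨n, hn, hne⟩ := hM (j + M)
  refine ⟨n + M, by omega, by push_cast; omega, ?_⟩
  rw [shift_symm_iterate_apply, add_sub_cancel_right]
  rwa [show n + M + j = n + (j + M) by ring]

/-- A periodic point `x₀` has a homoclinic point `z` outside its orbit. -/
theorem exists_homoclinic (hinf : Infinite (SFT A)) {μ : Measure (SFT A)} [IsProbabilityMeasure μ]
    (herg : Ergodic (shift A) μ) [μ.IsOpenPosMeasure] {x₀ : SFT A} {q : ℕ} (hq : 0 < q)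
    (hx₀ : ∀ n : ℤ, x₀.1 (n + q) = x₀.1 n) :
    ∃ (z : SFT A) (N : ℕ), (∀ n ≤ 0, z.1 n = x₀.1 n) ∧ (∀ n, 0 ≤ n → z.1 (n + N) = x₀.1 n) ∧
      ∀ j : ℤ, ∃ n, x₀.1 (n + j) ≠ z.1 n := by
  obtain ⟨w, L, hw⟩ := exists_word_not_in_orbit hinf hq hx₀
  have path : ∀ x y : SFT A, ∃ (n : ℕ) (u : SFT A), u.1 0 = x.1 0 ∧ u.1 n = y.1 0 := by
    intro x y
    obtain ⟨n, u, hu, hu'⟩ := exists_iterate_mem_of_ergodic continuous_shift herg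
      (isOpen_cylinder (x.1 0)) ⟨x, rfl⟩ (isOpen_cylinder (y.1 0)) ⟨y, rfl⟩
    refine ⟨n, u, hu, ?_⟩
    have h : ((shift A)^[n] u).1 0 = y.1 0 := hu'
    rwa [shift_iterate_apply, zero_add] at h
  obtain ⟨n₁, u₁, h₁, h₁'⟩ := path x₀ w
  obtain ⟨n₂, u₂, h₂, h₂'⟩ := path ((shift A)^[L] w) x₀
  rw [shift_iterate_apply, zero_add] at h₂
  -- concatenate: `x₀`, a path to the word, the word, a path back, `x₀`
  obtain ⟨a, ha, ha'⟩ := exists_concat u₂ x₀ n₂ h₂'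
  have ha0 : a.1 0 = w.1 L := by
    rcases Nat.eq_zero_or_pos n₂ with h | h
    · rw [ha' 0 (by omega), ← h₂]
      subst h
      simpa using h₂'.symm
    · rw [ha 0 (by omega), h₂]
  obtain ⟨b, hb, hb'⟩ := exists_concat w a L ha0.symm
  have hb0 : b.1 0 = w.1 0 := by
    rcases Nat.eq_zero_or_pos L with h | h
    · rw [hb' 0 (by omega)]
      subst h
      simpa using ha0
    · rw [hb 0 (by omega)]
  obtain ⟨c, hc, hc'⟩ := exists_concat u₁ b n₁ (h₁'.trans hb0.symm)
  have hc0 : c.1 0 = x₀.1 0 := by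
    rcases Nat.eq_zero_or_pos n₁ with h | h
    · rw [hc' 0 (by omega)]
      subst h
      simpa [hb0, h₁] using h₁'.symm
    · rw [hc 0 (by omega), h₁]
  obtain ⟨z, hz, hz'⟩ := exists_concat x₀ c 0 hc0.symm
  refine ⟨z, n₁ + L + n₂, fun n hn => ?_, fun n hn => ?_, fun j => ?_⟩
  · rcases hn.lt_or_eq with h | h
    · exact hz n h
    · rw [hz' n h.ge, h]
      simpa using hc0
  · rw [hz' _ (by omega), hc' _ (by push_cast; omega), hb' _ (by push_cast; omega),
      ha' _ (by push_cast; omega)]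
    exact congrArg x₀.1 (by push_cast; ring)
  · obtain ⟨n, hn, hn', hne⟩ := hw (j + n₁)
    refine ⟨n + n₁, ?_⟩
    rw [hz' _ (by omega), hc' _ (by omega), hb _ (by omega),
      show n + n₁ + j = n + (j + n₁) by ring, show n + n₁ - 0 - n₁ = n by ring]
    exact hne

/-- A homoclinic point outside the periodic orbit is isolated in the union of its own orbit and the
periodic orbit. -/
theorem exists_isolating_window {x₀ z : SFT A} {q N : ℕ} (hq : 0 < q)
    (hx₀ : ∀ n : ℤ, x₀.1 (n + q) = x₀.1 n) (hu : ∀ n ≤ 0, z.1 n = x₀.1 n)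
    (hs : ∀ n, 0 ≤ n → z.1 (n + N) = x₀.1 n) (hz : ∀ j : ℤ, ∃ n, x₀.1 (n + j) ≠ z.1 n) :
    ∃ M : ℕ, (∀ j : ℤ, ∃ n : ℤ, n.natAbs ≤ M ∧ x₀.1 (n + j) ≠ z.1 n) ∧
      ∀ j : ℤ, j ≠ 0 → ∃ n : ℤ, n.natAbs ≤ M ∧ z.1 (n + j) ≠ z.1 n := by
  obtain ⟨M₁, hM₁⟩ := exists_window_orbit hq hx₀ (z := z) fun j => hz j
  have haper : ∀ j : ℤ, ∃ n : ℤ, j ≠ 0 → z.1 (n + j) ≠ z.1 n := by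
    intro j
    by_contra! hc
    have hj : j ≠ 0 := (hc 0).1
    obtain ⟨n, hn⟩ := hz 0
    refine hn ?_
    rw [add_zero]
    -- move `n` to the past, where `z` and `x₀` agree, by a common period
    have h1 : n - n.natAbs * (j.sign * q) * j ≤ 0 := by
      have h2 : (n.natAbs : ℤ) * (j.sign * q) * j = n.natAbs * (q * (j.sign * j)) := by ring
      rw [h2, Int.sign_mul_self_eq_natAbs]
      have h3 : (1 : ℤ) ≤ q * j.natAbs := by
        exact_mod_cast Nat.mul_pos hq (Int.natAbs_pos.2 hj)
      nlinarith [Int.le_natAbs (a := n), Int.natCast_nonneg n.natAbs]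
    have h4 := coord_add_mul (fun n => (hc n).2) (-(n.natAbs * (j.sign * q))) n
    have h5 := coord_add_mul hx₀ (-(n.natAbs * j.sign * j)) n
    rw [← h4, ← h5]
    refine Eq.trans ?_ (hu _ (by linarith)).symm
    exact congrArg x₀.1 (by ring)
  choose ν hν using haper
  refine ⟨max M₁ ((Finset.Ioo (-(M₁ : ℤ)) (N + M₁)).sup fun j => (ν j).natAbs), fun j => ?_,
    fun j hj => ?_⟩
  · obtain ⟨n, hn, hne⟩ := hM₁ j
    exact ⟨n, le_max_of_le_left hn, hne⟩
  · by_cases h : j ∈ Finset.Ioo (-(M₁ : ℤ)) (N + M₁)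
    · exact ⟨ν j, le_max_of_le_right (Finset.le_sup (f := fun j => (ν j).natAbs) h), hν j hj⟩
    · rw [Finset.mem_Ioo, not_and_or, not_lt, not_lt] at h
      rcases h with h | h
      · obtain ⟨n, hn, hne⟩ := hM₁ j
        refine ⟨n, le_max_of_le_left hn, ?_⟩
        rwa [hu _ (by omega)]
      · obtain ⟨n, hn, hne⟩ := hM₁ (j - N)
        refine ⟨n, le_max_of_le_left hn, ?_⟩
        rwa [show n + j = n + (j - N) + N by ring, hs _ (by omega)]

end Subshift

/-! ### Hölder constants and rotations -/

section HolderConst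

variable {X Y : Type*} {dX : X → X → ℝ} {dY : Y → Y → ℝ} {a : ℝ}

theorem bddBelow_holderSet (f : X → Y) :
    BddBelow {C : ℝ | 0 ≤ C ∧ ∀ x y, dY (f x) (f y) ≤ C * dX x y ^ a} := ⟨0, fun _ h => h.1⟩

theorem IsHolder.nonempty {f : X → Y} (hX : ∀ x y, 0 ≤ dX x y) (hf : IsHolder dX dY a f) :
    {C : ℝ | 0 ≤ C ∧ ∀ x y, dY (f x) (f y) ≤ C * dX x y ^ a}.Nonempty := by
  obtain ⟨C, hC⟩ := hf
  exact ⟨max C 0, le_max_right _ _, fun x y => (hC x y).trans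
    (mul_le_mul_of_nonneg_right (le_max_left _ _) (Real.rpow_nonneg (hX x y) _))⟩

theorem holderConst_nonneg (f : X → Y) : 0 ≤ holderConst dX dY a f :=
  Real.sInf_nonneg fun _ h => h.1

/-- The infimum that defines the Hölder constant is attained. -/
theorem IsHolder.le_holderConst {f : X → Y} (hX : ∀ x y, 0 ≤ dX x y) (hf : IsHolder dX dY a f)
    (x y : X) : dY (f x) (f y) ≤ holderConst dX dY a f * dX x y ^ a := by
  rcases (Real.rpow_nonneg (hX x y) a).eq_or_lt with h | h
  · obtain ⟨C, hC⟩ := hf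
    simpa [← h] using hC x y
  · rw [← div_le_iff₀ h]
    exact le_csInf (hf.nonempty hX) fun C hC => (div_le_iff₀ h).2 (hC.2 x y)

theorem holderConst_le_add {f g : X → Y} (hX : ∀ x y, 0 ≤ dX x y) (hf : IsHolder dX dY a f) {η : ℝ}
    (hη : 0 ≤ η) (h : ∀ x y, dY (g x) (g y) ≤ dY (f x) (f y) + η * dX x y ^ a) :
    holderConst dX dY a g ≤ holderConst dX dY a f + η := by
  refine csInf_le (bddBelow_holderSet g) ⟨add_nonneg (holderConst_nonneg f) hη, fun x y => ?_⟩
  rw [add_mul]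
  exact (h x y).trans (add_le_add_left (hf.le_holderConst hX x y) _)

end HolderConst

theorem S1.dist_le_half (p q : S1) : dist p q ≤ 1 / 2 := by
  rw [dist_eq_norm]
  simpa using AddCircle.norm_le_half_period (1 : ℝ) (x := p - q) one_ne_zero

section BiHolder

variable {β : ℝ}

theorem bddAbove_dist (e₁ e₂ : S1 ≃ₜ S1) : BddAbove (Set.range fun p => dist (e₁ p) (e₂ p)) :=
  ⟨1 / 2, by rintro _ ⟨p, rfl⟩; exact S1.dist_le_half _ _⟩

theorem dist_le_dBeta (e₁ e₂ : S1 ≃ₜ S1) (p : S1) : dist (e₁ p) (e₂ p) ≤ dBeta β e₁ e₂ :=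
  (le_ciSup (bddAbove_dist e₁ e₂) p).trans (le_add_of_nonneg_right (abs_nonneg _))

theorem dBeta_nonneg (e₁ e₂ : S1 ≃ₜ S1) : 0 ≤ dBeta β e₁ e₂ :=
  dist_nonneg.trans (dist_le_dBeta e₁ e₂ 0)

theorem dBeta_comm (e₁ e₂ : S1 ≃ₜ S1) : dBeta β e₁ e₂ = dBeta β e₂ e₁ := by
  simp only [dBeta, dist_comm, abs_sub_comm]

theorem dBeta_triangle (e₁ e₂ e₃ : S1 ≃ₜ S1) :
    dBeta β e₁ e₃ ≤ dBeta β e₁ e₂ + dBeta β e₂ e₃ := by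
  have h : (⨆ p : S1, dist (e₁ p) (e₃ p)) ≤
      (⨆ p : S1, dist (e₁ p) (e₂ p)) + ⨆ p : S1, dist (e₂ p) (e₃ p) :=
    ciSup_le fun p => (dist_triangle _ (e₂ p) _).trans
      (add_le_add (le_ciSup (bddAbove_dist e₁ e₂) p) (le_ciSup (bddAbove_dist e₂ e₃) p))
  have h' := abs_sub_le (holderConst dist dist β e₁) (holderConst dist dist β e₂)
    (holderConst dist dist β e₃)
  unfold dBeta
  linarith

theorem dMax_nonneg (e₁ e₂ : BiHolder β) : 0 ≤ dMax e₁ e₂ :=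
  le_max_of_le_left (dBeta_nonneg _ _)

theorem dMax_comm (e₁ e₂ : BiHolder β) : dMax e₁ e₂ = dMax e₂ e₁ := by
  simp only [dMax, dBeta_comm]

theorem dMax_triangle (e₁ e₂ e₃ : BiHolder β) : dMax e₁ e₃ ≤ dMax e₁ e₂ + dMax e₂ e₃ :=
  max_le ((dBeta_triangle _ _ _).trans (add_le_add (le_max_left _ _) (le_max_left _ _)))
    ((dBeta_triangle _ _ _).trans (add_le_add (le_max_right _ _) (le_max_right _ _)))

theorem dist_le_dMax (e₁ e₂ : BiHolder β) (p : S1) :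
    dist (e₁.homeo p) (e₂.homeo p) ≤ dMax e₁ e₂ :=
  (dist_le_dBeta _ _ p).trans (le_max_left _ _)

theorem dist_symm_le_dMax (e₁ e₂ : BiHolder β) (p : S1) :
    dist (e₁.homeo.symm p) (e₂.homeo.symm p) ≤ dMax e₁ e₂ :=
  (dist_le_dBeta _ _ p).trans (le_max_right _ _)

/-- The homeomorphism `e` followed by the rotation by `t`. -/
def rotate (t : S1) (e : S1 ≃ₜ S1) : S1 ≃ₜ S1 := e.trans (Homeomorph.addRight t)

theorem rotate_apply (t : S1) (e : S1 ≃ₜ S1) (p : S1) : rotate t e p = e p + t := rfl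

theorem rotate_symm_apply (t : S1) (e : S1 ≃ₜ S1) (p : S1) :
    (rotate t e).symm p = e.symm (p + -t) := rfl

theorem holderConst_rotate (t : S1) (e : S1 ≃ₜ S1) :
    holderConst dist dist β (rotate t e) = holderConst dist dist β e := by
  simp only [holderConst, rotate_apply, dist_add_right]

theorem holderConst_rotate_symm (t : S1) (e : S1 ≃ₜ S1) :
    holderConst dist dist β (rotate t e).symm = holderConst dist dist β e.symm := by
  unfold holderConst
  congr 1
  ext C
  refine and_congr_right fun _ => ⟨fun h p q => ?_, fun h p q => ?_⟩
  · simpa [rotate_symm_apply] using h (p + t) (q + t)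
  · simpa [rotate_symm_apply] using h (p + -t) (q + -t)

/-- Rotations are isometries, so a rotated bi-Hölder homeomorphism is bi-Hölder with the same
constants. -/
def BiHolder.rotate (t : S1) (e : BiHolder β) : BiHolder β where
  homeo := _root_.rotate t e.homeo
  holder := by
    obtain ⟨C, hC⟩ := e.holder
    exact ⟨C, fun p q => by simpa [rotate_apply] using hC p q⟩
  holder_symm := by
    obtain ⟨C, hC⟩ := e.holder_symm
    exact ⟨C, fun p q => by simpa [rotate_symm_apply] using hC (p + -t) (q + -t)⟩

theorem dMax_rotate_rotate (t : S1) (e₁ e₂ : BiHolder β) :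
    dMax (e₁.rotate t) (e₂.rotate t) = dMax e₁ e₂ := by
  have h : (⨆ p : S1, dist (e₁.homeo.symm (p + -t)) (e₂.homeo.symm (p + -t))) =
      ⨆ p : S1, dist (e₁.homeo.symm p) (e₂.homeo.symm p) :=
    (Equiv.addRight (-t)).iSup_comp
      (g := fun p : S1 => dist (e₁.homeo.symm p) (e₂.homeo.symm p))
  simp only [dMax, dBeta, BiHolder.rotate, holderConst_rotate, holderConst_rotate_symm,
    rotate_apply, rotate_symm_apply, dist_add_right, h]

theorem dMax_rotate_le_half (t : S1) (e : BiHolder β) : dMax e (e.rotate t) ≤ 1 / 2 := by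
  simp only [dMax, dBeta, BiHolder.rotate, holderConst_rotate, holderConst_rotate_symm, sub_self,
    abs_zero, add_zero]
  exact max_le (ciSup_le fun p => S1.dist_le_half _ _) (ciSup_le fun p => S1.dist_le_half _ _)

theorem dMax_rotate_le (t : S1) (e : BiHolder β) {K : ℝ}
    (hK : holderConst dist dist β e.homeo.symm ≤ K) :
    dMax e (e.rotate t) ≤ max ‖t‖ (K * ‖t‖ ^ β) := by
  simp only [dMax, dBeta, BiHolder.rotate, holderConst_rotate, holderConst_rotate_symm, sub_self,
    abs_zero, add_zero]
  refine max_le_max (ciSup_le fun p => ?_) (ciSup_le fun p => ?_)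
  · simp [rotate_apply]
  · refine (e.holder_symm.le_holderConst (fun _ _ => dist_nonneg) _ _).trans ?_
    change _ * dist p (p + -t) ^ β ≤ _
    rw [show dist p (p + -t) = ‖t‖ by simp]
    exact mul_le_mul_of_nonneg_right hK (by positivity)

end BiHolder

/-! ### Rotating the fiber maps on a window -/

section RotateOn

variable {k : ℕ} {A : Fin k → Fin k → Prop} {ρ α β : ℝ}

/-- The points that agree with `z` at the times `-M, …, M`. -/
def window (z : SFT A) (M : ℕ) : Set (SFT A) := {x | ∀ n : ℤ, n.natAbs ≤ M → x.1 n = z.1 n}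

theorem mul_shiftDist_rpow_of_mem_window (hρ : 1 < ρ) (hα : 0 < α) {z x y : SFT A} {M : ℕ}
    (hx : x ∈ window z M) (hy : y ∉ window z M) :
    1 ≤ (ρ ^ (M : ℝ)) ^ α * shiftDist ρ x y ^ α := by
  have hy' : ∃ n : ℤ, n.natAbs ≤ M ∧ y.1 n ≠ z.1 n := by
    by_contra! hc
    exact hy hc
  obtain ⟨n, hn, hne⟩ := hy'
  have h := le_shiftDist hρ (x := x) (y := y) hn (by rw [hx n hn]; exact hne.symm)
  rw [← Real.mul_rpow (by positivity) (shiftDist_nonneg hρ _ _)]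
  refine Real.one_le_rpow ?_ hα.le
  calc (1 : ℝ) = ρ ^ (M : ℝ) * ρ ^ (-(M : ℝ)) := by
        rw [← Real.rpow_add (by linarith), add_neg_cancel, Real.rpow_zero]
    _ ≤ _ := by gcongr

theorem shiftDist_comm (x y : SFT A) : shiftDist ρ x y = shiftDist ρ y x := by
  simp only [shiftDist, eq_comm (a := x.1 _)]
  by_cases h : x = y
  · rw [if_pos h, if_pos h.symm]
  · rw [if_neg h, if_neg (Ne.symm h)]

/-- Families of fiber maps that differ by at most `η`, and whose increments agree between points on
the same side of a window, have increments that differ by a multiple of `η * d ^ α`: points on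
different sides of a window are far apart. -/
theorem dMax_le_dMax_add (hρ : 1 < ρ) (hα : 0 < α) {z : SFT A} {M : ℕ} {F G : SFT A → BiHolder β}
    {η : ℝ} (hη : ∀ x, dMax (F x) (G x) ≤ η)
    (hFG : ∀ x y, (x ∈ window z M ↔ y ∈ window z M) → dMax (G x) (G y) = dMax (F x) (F y))
    (x y : SFT A) :
    dMax (G x) (G y) ≤ dMax (F x) (F y) + 2 * η * (ρ ^ (M : ℝ)) ^ α * shiftDist ρ x y ^ α := by
  have hη0 : 0 ≤ η := (dMax_nonneg _ _).trans (hη x)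
  by_cases h : x ∈ window z M ↔ y ∈ window z M
  · rw [hFG x y h]
    have := Real.rpow_nonneg (shiftDist_nonneg hρ x y) α
    exact le_add_of_nonneg_right (by positivity)
  · have h1 : 1 ≤ (ρ ^ (M : ℝ)) ^ α * shiftDist ρ x y ^ α := by
      by_cases hx : x ∈ window z M
      · exact mul_shiftDist_rpow_of_mem_window hρ hα hx (by tauto)
      · rw [shiftDist_comm]
        exact mul_shiftDist_rpow_of_mem_window hρ hα (by tauto) hx
    have h2 := dMax_triangle (G x) (F x) (G y)
    have h3 := dMax_triangle (F x) (F y) (G y)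
    have h4 := hη x
    have h5 := hη y
    rw [dMax_comm] at h4
    have h6 : 2 * η * 1 ≤ 2 * η * ((ρ ^ (M : ℝ)) ^ α * shiftDist ρ x y ^ α) := by gcongr
    rw [mul_assoc (2 * η)]
    linarith

open Classical in
/-- The fiber maps `f_x`, rotated by `t` for the points `x` of a window. -/
noncomputable def rotateFiber (f : SFT A → BiHolder β) (z : SFT A) (M : ℕ) (t : S1)
    (x : SFT A) : BiHolder β :=
  if x ∈ window z M then (f x).rotate t else f x

theorem dMax_rotateFiber (f : SFT A → BiHolder β) (z : SFT A) (M : ℕ) (t : S1) {x y : SFT A}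
    (h : x ∈ window z M ↔ y ∈ window z M) :
    dMax (rotateFiber f z M t x) (rotateFiber f z M t y) = dMax (f x) (f y) := by
  unfold rotateFiber
  by_cases hx : x ∈ window z M
  · rw [if_pos hx, if_pos (h.1 hx), dMax_rotate_rotate]
  · rw [if_neg hx, if_neg (mt h.2 hx)]

theorem dMax_self {e : BiHolder β} : dMax e e = 0 := by simp [dMax, dBeta]

theorem dMax_rotateFiber_le (f : SFT A → BiHolder β) (z : SFT A) (M : ℕ) (t : S1) {η : ℝ}
    (hη : ∀ x, dMax (f x) ((f x).rotate t) ≤ η) (x : SFT A) :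
    dMax (f x) (rotateFiber f z M t x) ≤ η := by
  unfold rotateFiber
  split_ifs
  · exact hη x
  · rw [dMax_self]
    exact (dMax_nonneg _ _).trans (hη x)

/-- The cocycle `f`, rotated by `t` on a window. -/
noncomputable def HolderCocycle.rotateOn (f : HolderCocycle A ρ α β) (hρ : 1 < ρ) (hα : 0 < α)
    (z : SFT A) (M : ℕ) (t : S1) : HolderCocycle A ρ α β where
  fiber := rotateFiber f.fiber z M t
  holder := by
    obtain ⟨C, hC⟩ := f.holder
    refine ⟨C + 2 * (1 / 2) * (ρ ^ (M : ℝ)) ^ α, fun x y => ?_⟩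
    rw [add_mul]
    exact (dMax_le_dMax_add hρ hα
      (dMax_rotateFiber_le f.fiber z M t fun x => dMax_rotate_le_half t _)
      (fun x y => dMax_rotateFiber f.fiber z M t) x y).trans (add_le_add_left (hC x y) _)

theorem rotateOn_map_of_mem (f : HolderCocycle A ρ α β) (hρ : 1 < ρ) (hα : 0 < α) {z x : SFT A}
    {M : ℕ} (t : S1) (hx : x ∈ window z M) :
    (f.rotateOn hρ hα z M t).map x = rotate t (f.map x) := by
  simp only [HolderCocycle.map, HolderCocycle.rotateOn, rotateFiber, if_pos hx, BiHolder.rotate]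

theorem rotateOn_map_of_notMem (f : HolderCocycle A ρ α β) (hρ : 1 < ρ) (hα : 0 < α) {z x : SFT A}
    {M : ℕ} (t : S1) (hx : x ∉ window z M) : (f.rotateOn hρ hα z M t).map x = f.map x := by
  simp only [HolderCocycle.map, HolderCocycle.rotateOn, rotateFiber, if_neg hx]

theorem HolderCocycle.IsSUDominated.rotateOn {f : HolderCocycle A ρ α β} (hf : f.IsSUDominated)
    (hρ : 1 < ρ) (hα : 0 < α) (z : SFT A) (M : ℕ) (t : S1) :
    (f.rotateOn hρ hα z M t).IsSUDominated := by
  obtain ⟨c, hc, h⟩ := hf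
  refine ⟨c, hc, fun x => ?_⟩
  by_cases hx : x ∈ window z M
  · rw [rotateOn_map_of_mem f hρ hα t hx, holderConst_rotate, holderConst_rotate_symm]
    exact h x
  · rw [rotateOn_map_of_notMem f hρ hα t hx]
    exact h x

theorem dAlpha_rotateOn_le (f : HolderCocycle A ρ α β) (hρ : 1 < ρ) (hα : 0 < α) (z : SFT A) (M : ℕ)
    (t : S1) {η : ℝ} (hη : ∀ x, dMax (f.fiber x) ((f.fiber x).rotate t) ≤ η) :
    dAlpha f (f.rotateOn hρ hα z M t) ≤ η + 2 * η * (ρ ^ (M : ℝ)) ^ α := by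
  have : Nonempty (SFT A) := ⟨z⟩
  have hη0 : 0 ≤ η := (dMax_nonneg _ _).trans (hη z)
  have h := dMax_rotateFiber_le f.fiber z M t hη
  refine add_le_add (ciSup_le h) (abs_sub_le_iff.2 ⟨?_, ?_⟩)
  · rw [sub_le_iff_le_add']
    exact holderConst_le_add (shiftDist_nonneg hρ) (f.rotateOn hρ hα z M t).holder (by positivity)
      (dMax_le_dMax_add hρ hα (fun x => by rw [dMax_comm]; exact h x)
        fun x y hxy => (dMax_rotateFiber f.fiber z M t hxy).symm)
  · rw [sub_le_iff_le_add']
    exact holderConst_le_add (shiftDist_nonneg hρ) f.holder (by positivity)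
      (dMax_le_dMax_add hρ hα h fun x y hxy => dMax_rotateFiber f.fiber z M t hxy)

theorem eventually_dAlpha_rotateOn_lt {f : HolderCocycle A ρ α β} (hf : f.IsSUDominated)
    (hρ : 1 < ρ) (hα : 0 < α) (hβ : 0 < β) (z : SFT A) (M : ℕ) {ε : ℝ} (hε : 0 < ε) :
    ∀ᶠ t in 𝓝 (0 : S1), dAlpha f (f.rotateOn hρ hα z M t) < ε := by
  obtain ⟨c, -, hc⟩ := hf
  have hK : ∀ x, holderConst dist dist β (f.map x).symm ≤ c * ρ ^ (α * β) := fun x => by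
    have h := (hc x).2
    rwa [Real.rpow_neg (by linarith), ← div_eq_mul_inv, div_le_iff₀ (by positivity)] at h
  let η : S1 → ℝ := fun t => max ‖t‖ (c * ρ ^ (α * β) * ‖t‖ ^ β)
  have hη : Continuous η := by
    refine continuous_norm.max (continuous_const.mul ?_)
    exact continuous_norm.rpow_const fun _ => Or.inr hβ.le
  have h0 : η 0 = 0 := by simp [η, Real.zero_rpow hβ.ne']
  have hlim : Tendsto (fun t => η t + 2 * η t * (ρ ^ (M : ℝ)) ^ α) (𝓝 0) (𝓝 0) := by
    have h1 : Continuous fun t => η t + 2 * η t * (ρ ^ (M : ℝ)) ^ α := by fun_prop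
    simpa [h0] using h1.tendsto 0
  filter_upwards [hlim.eventually_lt_const hε] with t ht
  exact (dAlpha_rotateOn_le f hρ hα z M t fun x => dMax_rotate_le t _ (hK x)).trans_lt ht

end RotateOn

/-! ### Holonomies by the graph transform -/

section GraphTransform

variable {X : Type*}

/-- The iterates of the fiber maps `F` along the orbits of `S`. -/
def fiberIter (S : X → X) (F : X → S1 ≃ₜ S1) : ℕ → X → (S1 ≃ₜ S1)
  | 0, _ => Homeomorph.refl S1
  | n + 1, x => (fiberIter S F n x).trans (F (S^[n] x))

theorem fiberIter_succ_apply (S : X → X) (F : X → S1 ≃ₜ S1) (n : ℕ) (x : X) (p : S1) :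
    fiberIter S F (n + 1) x p = F (S^[n] x) (fiberIter S F n x p) := rfl

theorem fiberIter_succ_apply' (S : X → X) (F : X → S1 ≃ₜ S1) (n : ℕ) (x : X) (p : S1) :
    fiberIter S F (n + 1) x p = fiberIter S F n (S x) (F x p) := by
  induction n with
  | zero => rfl
  | succ n ih => rw [fiberIter_succ_apply, ih, fiberIter_succ_apply]; rfl

theorem fiberIter_succ_symm_apply' (S : X → X) (F : X → S1 ≃ₜ S1) (n : ℕ) (x : X) (p : S1) :
    (fiberIter S F (n + 1) x).symm p = (F x).symm ((fiberIter S F n (S x)).symm p) := by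
  rw [Homeomorph.symm_apply_eq, fiberIter_succ_apply']
  simp

/-- The approximations `(F^n_y)⁻¹ ∘ F^n_x` of the holonomy from `x` to `y`. -/
def graphTransform (S : X → X) (F : X → S1 ≃ₜ S1) (n : ℕ) (x y : X) (p : S1) : S1 :=
  (fiberIter S F n y).symm (fiberIter S F n x p)

theorem graphTransform_comp (S : X → X) (F : X → S1 ≃ₜ S1) (n : ℕ) (x y z : X) (p : S1) :
    graphTransform S F n y z (graphTransform S F n x y p) = graphTransform S F n x z p := by
  simp [graphTransform]

/-- The fiber maps are bi-Lipschitz with constant `Λ`, and along the orbits of `W`-equivalent points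
they approach each other at a rate `r` with `Λ * r < 1`. -/
structure IsDominated [TopologicalSpace X] (S : X → X) (F : X → S1 ≃ₜ S1) (W : X → X → Prop)
    (Λ K r : ℝ) : Prop where
  continuous_base : Continuous S
  continuous_fiber : Continuous fun q : X × S1 => F q.1 q.2
  continuous_fiber_symm : Continuous fun q : X × S1 => (F q.1).symm q.2
  equivalence : Equivalence W
  map_rel : ∀ {x y}, W x y → W (S x) (S y)
  lipschitz : ∀ x p q, dist (F x p) (F x q) ≤ Λ * dist p q
  lipschitz_symm : ∀ x p q, dist ((F x).symm p) ((F x).symm q) ≤ Λ * dist p q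
  approach : ∀ x y, W x y → ∀ n p, dist ((F (S^[n] x)).symm p) ((F (S^[n] y)).symm p) ≤ K * r ^ n
  one_le : 1 ≤ Λ
  nonneg : 0 ≤ K
  pos : 0 < r
  mul_lt_one : Λ * r < 1

namespace IsDominated

variable [TopologicalSpace X] {S : X → X} {F : X → S1 ≃ₜ S1} {W : X → X → Prop} {Λ K r : ℝ}

theorem dist_fiberIter_le (h : IsDominated S F W Λ K r) (n : ℕ) (x : X) (p q : S1) :
    dist (fiberIter S F n x p) (fiberIter S F n x q) ≤ Λ ^ n * dist p q := by
  induction n with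
  | zero => simp [fiberIter]
  | succ n ih =>
    have := h.one_le
    rw [fiberIter_succ_apply, fiberIter_succ_apply, pow_succ', mul_assoc]
    exact (h.lipschitz _ _ _).trans (by gcongr)

theorem dist_fiberIter_symm_le (h : IsDominated S F W Λ K r) (n : ℕ) (x : X) (p q : S1) :
    dist ((fiberIter S F n x).symm p) ((fiberIter S F n x).symm q) ≤ Λ ^ n * dist p q := by
  induction n generalizing x with
  | zero => simp [fiberIter]
  | succ n ih =>
    have := h.one_le
    rw [fiberIter_succ_symm_apply', fiberIter_succ_symm_apply', pow_succ', mul_assoc]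
    exact (h.lipschitz_symm _ _ _).trans (by gcongr; exact ih _)

theorem dist_graphTransform_le (h : IsDominated S F W Λ K r) (n : ℕ) (x y : X) (p q : S1) :
    dist (graphTransform S F n x y p) (graphTransform S F n x y q) ≤ (Λ ^ 2) ^ n * dist p q := by
  have := h.one_le
  calc _ ≤ Λ ^ n * (Λ ^ n * dist p q) :=
        (h.dist_fiberIter_symm_le n y _ _).trans (by gcongr; exact h.dist_fiberIter_le n x p q)
    _ = _ := by ring

theorem dist_graphTransform_succ_le (h : IsDominated S F W Λ K r) {x y : X} (hxy : W x y) (p : S1)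
    (n : ℕ) :
    dist (graphTransform S F n x y p) (graphTransform S F (n + 1) x y p) ≤ K * (Λ * r) ^ n := by
  have h0 := h.one_le
  have h1 : graphTransform S F (n + 1) x y p =
      (fiberIter S F n y).symm ((F (S^[n] y)).symm (F (S^[n] x) (fiberIter S F n x p))) := rfl
  rw [h1]
  refine (h.dist_fiberIter_symm_le n y _ _).trans ?_
  rw [mul_pow, mul_left_comm]
  gcongr
  simpa using h.approach x y hxy n (F (S^[n] x) (fiberIter S F n x p))

theorem mul_pos (h : IsDominated S F W Λ K r) : 0 < Λ * r :=
  _root_.mul_pos (by linarith [h.one_le]) h.pos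

/-- The limit of the graph transforms. -/
noncomputable def graphLimit (_ : IsDominated S F W Λ K r) (x y : X) (p : S1) : S1 :=
  limUnder atTop fun n => graphTransform S F n x y p

theorem tendsto_graphLimit (h : IsDominated S F W Λ K r) {x y : X} (hxy : W x y) (p : S1) :
    Tendsto (fun n => graphTransform S F n x y p) atTop (𝓝 (h.graphLimit x y p)) :=
  (cauchySeq_of_le_geometric _ _ h.mul_lt_one
    (h.dist_graphTransform_succ_le hxy p)).tendsto_limUnder

theorem dist_graphLimit_le (h : IsDominated S F W Λ K r) {x y : X} (hxy : W x y) (p : S1) (n : ℕ) :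
    dist (graphTransform S F n x y p) (h.graphLimit x y p) ≤ K / (1 - Λ * r) * (Λ * r) ^ n := by
  refine (dist_le_of_le_geometric_of_tendsto _ _ h.mul_lt_one (h.dist_graphTransform_succ_le hxy p)
    (h.tendsto_graphLimit hxy p) n).trans_eq ?_
  ring

theorem tendsto_bound (h : IsDominated S F W Λ K r) :
    Tendsto (fun n : ℕ => K / (1 - Λ * r) * (Λ * r) ^ n) atTop (𝓝 0) := by
  simpa using (tendsto_pow_atTop_nhds_zero_of_lt_one h.mul_pos.le h.mul_lt_one).const_mul _

theorem continuous_fiberIter (h : IsDominated S F W Λ K r) (n : ℕ) :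
    Continuous fun q : X × S1 => fiberIter S F n q.1 q.2 := by
  induction n with
  | zero => exact continuous_snd
  | succ n ih =>
    exact h.continuous_fiber.comp
      (((h.continuous_base.iterate n).comp continuous_fst).prodMk ih)

theorem continuous_fiberIter_symm (h : IsDominated S F W Λ K r) (n : ℕ) :
    Continuous fun q : X × S1 => (fiberIter S F n q.1).symm q.2 := by
  induction n with
  | zero => exact continuous_snd
  | succ n ih =>
    exact ih.comp (continuous_fst.prodMk (h.continuous_fiber_symm.comp
      (((h.continuous_base.iterate n).comp continuous_fst).prodMk continuous_snd)))

theorem continuousOn_graphLimit (h : IsDominated S F W Λ K r) :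
    ContinuousOn (fun q : (X × X) × S1 => h.graphLimit q.1.1 q.1.2 q.2) {q | W q.1.1 q.1.2} := by
  have hc : ∀ n, Continuous fun q : (X × X) × S1 => graphTransform S F n q.1.1 q.1.2 q.2 := fun n =>
    (h.continuous_fiberIter_symm n).comp ((continuous_snd.comp continuous_fst).prodMk
      ((h.continuous_fiberIter n).comp
        ((continuous_fst.comp continuous_fst).prodMk continuous_snd)))
  refine TendstoUniformlyOn.continuousOn (p := atTop)
    (F := fun n q => graphTransform S F n q.1.1 q.1.2 q.2) ?_
    (Frequently.of_forall fun n => (hc n).continuousOn)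
  rw [Metric.tendstoUniformlyOn_iff]
  intro ε hε
  filter_upwards [h.tendsto_bound.eventually_lt_const hε] with n hn q hq
  rw [dist_comm]
  exact (h.dist_graphLimit_le hq q.2 n).trans_lt hn

theorem continuous_graphLimit (h : IsDominated S F W Λ K r) {x y : X} (hxy : W x y) :
    Continuous (h.graphLimit x y) := by
  have h1 : Continuous fun p : S1 => ((x, y), p) := by fun_prop
  have h2 : ∀ p : S1, ((x, y), p) ∈ {q : (X × X) × S1 | W q.1.1 q.1.2} := fun _ => hxy
  have h3 := ContinuousOn.comp_continuous h.continuousOn_graphLimit h1 h2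
  exact h3

theorem graphLimit_self (h : IsDominated S F W Λ K r) (x : X) (p : S1) :
    h.graphLimit x x p = p :=
  tendsto_nhds_unique (h.tendsto_graphLimit (h.equivalence.refl x) p) (by simp [graphTransform])

theorem graphLimit_comp (h : IsDominated S F W Λ K r) {x y z : X} (hxy : W x y) (hyz : W y z)
    (p : S1) : h.graphLimit y z (h.graphLimit x y p) = h.graphLimit x z p := by
  refine tendsto_nhds_unique ?_ (h.tendsto_graphLimit (h.equivalence.trans hxy hyz) p)
  have h1 := ((h.continuous_graphLimit hyz).tendsto _).comp (h.tendsto_graphLimit hxy p)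
  have h2 : ∀ n, dist (h.graphLimit y z (graphTransform S F n x y p)) (graphTransform S F n x z p) ≤
      K / (1 - Λ * r) * (Λ * r) ^ n := fun n => by
    rw [← graphTransform_comp S F n x y z p, dist_comm]
    exact h.dist_graphLimit_le hyz (graphTransform S F n x y p) n
  exact h1.congr_dist (squeeze_zero (fun _ => dist_nonneg) h2 h.tendsto_bound)

theorem graphLimit_map (h : IsDominated S F W Λ K r) {x y : X} (hxy : W x y) (p : S1) :
    h.graphLimit (S x) (S y) p = F y (h.graphLimit x y ((F x).symm p)) := by
  refine tendsto_nhds_unique (h.tendsto_graphLimit (h.map_rel hxy) p) ?_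
  have h1 := ((F y).continuous.tendsto _).comp
    ((h.tendsto_graphLimit hxy ((F x).symm p)).comp (tendsto_add_atTop_nat 1))
  refine h1.congr fun n => ?_
  simp only [Function.comp_apply, graphTransform, fiberIter_succ_symm_apply',
    fiberIter_succ_apply', Homeomorph.apply_symm_apply]

/-- The limit of the graph transforms is Hölder: it is at distance `O ((Λ r) ^ n)` from a map with
Lipschitz constant `Λ ^ (2 n)`, and `n` can be chosen according to the distance of the points. -/
theorem exists_holder_graphLimit (h : IsDominated S F W Λ K r) :
    ∃ C γ : ℝ, 0 < γ ∧ ∀ x y, W x y → ∀ p q,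
      dist (h.graphLimit x y p) (h.graphLimit x y q) ≤ C * dist p q ^ γ := by
  have hc0 := h.mul_pos
  have hc1 := h.mul_lt_one
  have hΛ := h.one_le
  set c := Λ * r
  have hQ : 1 < Λ ^ 2 / c := by
    rw [one_lt_div hc0]
    nlinarith
  set Q := Λ ^ 2 / c
  have hlogQ : 0 < Real.log Q := Real.log_pos hQ
  have hlogc : Real.log c < 0 := Real.log_neg hc0 hc1
  -- the exponent for which `c = Q ^ (-γ)`
  set γ := -Real.log c / Real.log Q with hγ
  have hγ0 : 0 < γ := div_pos (by linarith) hlogQ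
  have hcQ : c = Q ^ (-γ) := by
    rw [Real.rpow_def_of_pos (by linarith), hγ, neg_div, neg_neg, mul_div_cancel₀ _ hlogQ.ne',
      Real.exp_log hc0]
  set B := K / (1 - c)
  have hB : 0 ≤ B := div_nonneg h.nonneg (by linarith)
  refine ⟨(2 * B + 1) * c⁻¹, γ, hγ0, fun x y hxy p q => ?_⟩
  rcases (dist_nonneg (x := p) (y := q)).eq_or_lt with hd | hd
  · rw [dist_eq_zero.1 hd.symm]
    simp [Real.zero_rpow hγ0.ne']
  -- this `n` makes `Λ ^ (2 n) * dist p q` comparable to `c ^ n`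
  obtain ⟨n, hn, hn'⟩ := exists_nat_pow_near (x := (dist p q)⁻¹)
    ((one_le_inv₀ hd).2 (by linarith [S1.dist_le_half p q])) hQ
  have h1 : (Λ ^ 2) ^ n * dist p q ≤ c ^ n := by
    have h2 : (Λ ^ 2) ^ n = c ^ n * Q ^ n := by
      rw [← mul_pow, mul_div_cancel₀ _ hc0.ne']
    rw [h2, mul_assoc]
    refine mul_le_of_le_one_right (by positivity) ?_
    calc Q ^ n * dist p q ≤ (dist p q)⁻¹ * dist p q := by gcongr
      _ = 1 := inv_mul_cancel₀ hd.ne'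
  have h3 : c ^ (n + 1) ≤ dist p q ^ γ := by
    have h4 : c ^ (n + 1) = (Q ^ (n + 1)) ^ (-γ) := by
      rw [hcQ, ← Real.rpow_natCast, ← Real.rpow_natCast, ← Real.rpow_mul (by positivity),
        ← Real.rpow_mul (by positivity), mul_comm]
    have h5 : dist p q ^ γ = ((dist p q)⁻¹) ^ (-γ) := by
      rw [Real.inv_rpow hd.le, Real.rpow_neg hd.le, inv_inv]
    rw [h4, h5]
    exact Real.rpow_le_rpow_of_nonpos (by positivity) hn'.le (by linarith)
  calc dist (h.graphLimit x y p) (h.graphLimit x y q)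
      ≤ dist (h.graphLimit x y p) (graphTransform S F n x y p)
        + dist (graphTransform S F n x y p) (graphTransform S F n x y q)
        + dist (graphTransform S F n x y q) (h.graphLimit x y q) := dist_triangle4 _ _ _ _
    _ ≤ B * c ^ n + c ^ n + B * c ^ n := by
        gcongr
        · rw [dist_comm]
          exact h.dist_graphLimit_le hxy p n
        · exact (h.dist_graphTransform_le n x y p q).trans h1
        · exact h.dist_graphLimit_le hxy q n
    _ = (2 * B + 1) * c⁻¹ * c ^ (n + 1) := by field_simp; ring
    _ ≤ _ := by gcongr

open Classical in
/-- The limit of the graph transforms as a homeomorphism; the identity for points that are not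
`W`-equivalent. -/
noncomputable def holonomy (h : IsDominated S F W Λ K r) (x y : X) : S1 ≃ₜ S1 :=
  if hxy : W x y then
    { toFun := h.graphLimit x y
      invFun := h.graphLimit y x
      left_inv := fun p => by
        rw [h.graphLimit_comp hxy (h.equivalence.symm hxy), h.graphLimit_self]
      right_inv := fun p => by
        rw [h.graphLimit_comp (h.equivalence.symm hxy) hxy, h.graphLimit_self]
      continuous_toFun := h.continuous_graphLimit hxy
      continuous_invFun := h.continuous_graphLimit (h.equivalence.symm hxy) }
  else Homeomorph.refl S1

theorem holonomy_apply (h : IsDominated S F W Λ K r) {x y : X} (hxy : W x y) (p : S1) :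
    h.holonomy x y p = h.graphLimit x y p := by
  simp only [holonomy, dif_pos hxy]
  rfl

end IsDominated

end GraphTransform

/-! ### Holonomies of dominated cocycles of Lipschitz maps -/

section Holonomies

variable {k : ℕ} {A : Fin k → Fin k → Prop} {ρ α β : ℝ}

theorem continuous_uncurry_of_holder (hρ : 1 < ρ) (hα : 0 < α) {F : SFT A → S1 ≃ₜ S1} {C : ℝ}
    (hF : ∀ x y p, dist (F x p) (F y p) ≤ C * shiftDist ρ x y ^ α) :
    Continuous fun q : SFT A × S1 => F q.1 q.2 := by
  rw [continuous_iff_continuousAt]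
  rintro ⟨x, p⟩
  have h1 : Tendsto (fun q : SFT A × S1 => F x q.2) (𝓝 (x, p)) (𝓝 (F x p)) :=
    ((F x).continuous.comp continuous_snd).tendsto (x, p)
  refine h1.congr_dist (squeeze_zero (fun _ => dist_nonneg) (fun q => hF x q.1 q.2) ?_)
  have h2 : Tendsto (fun q : SFT A × S1 => shiftDist ρ x q.1 ^ α) (𝓝 (x, p)) (𝓝 0) :=
    (tendsto_shiftDist_rpow hρ hα x).comp continuous_fst.continuousAt
  simpa using h2.const_mul C

theorem HolderCocycle.exists_dist_le (f : HolderCocycle A ρ α β) (hρ : 1 < ρ) : ∃ C : ℝ, 0 ≤ C ∧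
    (∀ x y p, dist (f.map x p) (f.map y p) ≤ C * shiftDist ρ x y ^ α) ∧
    ∀ x y p, dist ((f.map x).symm p) ((f.map y).symm p) ≤ C * shiftDist ρ x y ^ α := by
  obtain ⟨C, hC, h⟩ := f.holder.nonempty (shiftDist_nonneg hρ)
  exact ⟨C, hC, fun x y p => (dist_le_dMax _ _ p).trans (h x y),
    fun x y p => (dist_symm_le_dMax _ _ p).trans (h x y)⟩

theorem HolderCocycle.continuous_map (f : HolderCocycle A ρ α β) (hρ : 1 < ρ) (hα : 0 < α) :
    Continuous fun q : SFT A × S1 => f.map q.1 q.2 := by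
  obtain ⟨C, -, h, -⟩ := f.exists_dist_le hρ
  exact continuous_uncurry_of_holder hρ hα h

theorem HolderCocycle.continuous_map_symm (f : HolderCocycle A ρ α β) (hρ : 1 < ρ) (hα : 0 < α) :
    Continuous fun q : SFT A × S1 => (f.map q.1).symm q.2 := by
  obtain ⟨C, -, -, h⟩ := f.exists_dist_le hρ
  exact continuous_uncurry_of_holder hρ hα h

theorem equivalence_localStable : Equivalence fun x y : SFT A => y ∈ localStable x :=
  ⟨fun _ _ _ => rfl, fun h n hn => (h n hn).symm, fun h h' n hn => (h' n hn).trans (h n hn)⟩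

theorem equivalence_localUnstable : Equivalence fun x y : SFT A => y ∈ localUnstable x :=
  ⟨fun _ _ _ => rfl, fun h n hn => (h n hn).symm, fun h h' n hn => (h' n hn).trans (h n hn)⟩

theorem HolderCocycle.iter_eq (f : HolderCocycle A ρ α β) (n : ℕ) (x : SFT A) :
    f.iter n x = fiberIter (shift A) f.map n x := by
  induction n with
  | zero => rfl
  | succ n ih => rw [HolderCocycle.iter, fiberIter, ih]

/-- Iterates of the inverse cocycle, `x ↦ (f_{σ⁻¹ x})⁻¹` over `σ⁻¹`. -/
theorem HolderCocycle.fiberIter_inverse (f : HolderCocycle A ρ α β) (n : ℕ) (x : SFT A) :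
    fiberIter (shift A).symm (fun y => (f.map ((shift A).symm y)).symm) n x =
      (f.iter n ((shift A).symm^[n] x)).symm := by
  induction n with
  | zero => rfl
  | succ n ih =>
    ext p
    rw [fiberIter_succ_apply, ih, Homeomorph.eq_symm_apply, f.iter_eq, fiberIter_succ_apply',
      ← f.iter_eq, Function.iterate_succ_apply']
    simp

theorem rpow_neg_nat_rpow (hρ : 1 < ρ) (n : ℕ) :
    (ρ ^ (-(n : ℝ))) ^ α = (ρ ^ (-α)) ^ n := by
  rw [← Real.rpow_mul (by linarith), ← Real.rpow_natCast, ← Real.rpow_mul (by linarith)]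
  congr 1
  ring

/-- Uniform Lipschitz constants of a dominated cocycle of bi-Lipschitz maps. -/
theorem HolderCocycle.IsSUDominated.exists_lipschitz {f : HolderCocycle A ρ α 1}
    (hf : f.IsSUDominated) (hρ : 1 < ρ) (hα : 0 < α) :
    ∃ Λ : ℝ, 1 ≤ Λ ∧ Λ * ρ ^ (-α) < 1 ∧ ∀ x p q, dist (f.map x p) (f.map x q) ≤ Λ * dist p q ∧
      dist ((f.map x).symm p) ((f.map x).symm q) ≤ Λ * dist p q := by
  obtain ⟨c, hc, h⟩ := hf
  rw [mul_one] at h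
  have hpos : 0 < ρ ^ (-α) := by positivity
  refine ⟨max 1 (c / ρ ^ (-α)), le_max_left _ _, ?_, fun x p q => ⟨?_, ?_⟩⟩
  · rw [max_mul_of_nonneg _ _ hpos.le, one_mul, div_mul_cancel₀ _ hpos.ne']
    exact max_lt (Real.rpow_lt_one_of_one_lt_of_neg hρ (by linarith)) hc
  · have h1 := (f.fiber x).holder.le_holderConst (fun _ _ => dist_nonneg) p q
    rw [Real.rpow_one] at h1
    refine h1.trans (mul_le_mul_of_nonneg_right (le_max_of_le_right ?_) dist_nonneg)
    exact (le_div_iff₀ hpos).2 (h x).1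
  · have h1 := (f.fiber x).holder_symm.le_holderConst (fun _ _ => dist_nonneg) p q
    rw [Real.rpow_one] at h1
    refine h1.trans (mul_le_mul_of_nonneg_right (le_max_of_le_right ?_) dist_nonneg)
    exact (le_div_iff₀ hpos).2 (h x).2

theorem HolderCocycle.IsSUDominated.hasHolonomies {f : HolderCocycle A ρ α 1}
    (hf : f.IsSUDominated) (hρ : 1 < ρ) (hα : 0 < α) : f.HasHolonomies := by
  obtain ⟨Λ, hΛ, hΛ1, hLip⟩ := hf.exists_lipschitz hρ hα
  obtain ⟨C, hC, hd, hd'⟩ := f.exists_dist_le hρ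
  have happ : ∀ (n : ℕ) (x y : SFT A), (∀ m : ℤ, |m| < (n : ℤ) → x.1 m = y.1 m) →
      C * shiftDist ρ x y ^ α ≤ C * (ρ ^ (-α)) ^ n := fun n x y h => by
    rw [← rpow_neg_nat_rpow hρ]
    exact mul_le_mul_of_nonneg_left
      (Real.rpow_le_rpow (shiftDist_nonneg hρ _ _) (shiftDist_le hρ h) hα.le) hC
  constructor
  · have D : IsDominated (shift A) f.map (fun x y => y ∈ localStable x) Λ C (ρ ^ (-α)) :=
      { continuous_base := continuous_shift
        continuous_fiber := f.continuous_map hρ hα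
        continuous_fiber_symm := f.continuous_map_symm hρ hα
        equivalence := equivalence_localStable
        map_rel := fun h n hn => h (n + 1) (by omega)
        lipschitz := fun x p q => (hLip x p q).1
        lipschitz_symm := fun x p q => (hLip x p q).2
        approach := fun x y hxy n p => (hd' _ _ p).trans <| happ _ _ _ fun m hm => by
          rw [shift_iterate_apply, shift_iterate_apply, hxy _ (by linarith [(abs_lt.1 hm).1])]
        one_le := hΛ
        nonneg := hC
        pos := by positivity
        mul_lt_one := hΛ1 }
    have key : ∀ {x y} (_ : y ∈ localStable x) (p : S1), D.holonomy x y p = D.graphLimit x y p :=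
      fun hxy p => D.holonomy_apply hxy p
    refine ⟨D.holonomy, fun x p => ?_, fun x y z hxy hxz p => ?_, fun x y hxy p => ?_, ?_, ?_,
      fun x y hxy p => ?_⟩
    · rw [key (D.equivalence.refl x), D.graphLimit_self]
    · have hyz := D.equivalence.trans (D.equivalence.symm hxy) hxz
      rw [key hxy, key hyz, key hxz, D.graphLimit_comp hxy hyz]
    · rw [key (D.map_rel hxy), key hxy, D.graphLimit_map hxy]
    · exact D.continuousOn_graphLimit.congr fun q hq => key hq _
    · obtain ⟨C, γ, hγ, h⟩ := D.exists_holder_graphLimit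
      exact ⟨C, γ, hγ, fun x y hxy p q => by rw [key hxy, key hxy]; exact h x y hxy p q⟩
    · rw [key hxy]
      simpa only [graphTransform, f.iter_eq] using D.tendsto_graphLimit hxy p
  · have D : IsDominated (shift A).symm (fun y => (f.map ((shift A).symm y)).symm)
        (fun x y => y ∈ localUnstable x) Λ C (ρ ^ (-α)) :=
      { continuous_base := continuous_shift_symm
        continuous_fiber := (f.continuous_map_symm hρ hα).comp
          ((continuous_shift_symm.comp continuous_fst).prodMk continuous_snd)
        continuous_fiber_symm := (f.continuous_map hρ hα).comp
          ((continuous_shift_symm.comp continuous_fst).prodMk continuous_snd)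
        equivalence := equivalence_localUnstable
        map_rel := fun h n hn => h (n - 1) (by omega)
        lipschitz := fun x p q => (hLip _ p q).2
        lipschitz_symm := fun x p q => (hLip _ p q).1
        approach := fun x y hxy n p => (hd _ _ p).trans <| happ _ _ _ fun m hm => by
          rw [← Function.iterate_succ_apply' (shift A).symm,
            ← Function.iterate_succ_apply' (shift A).symm, shift_symm_iterate_apply,
            shift_symm_iterate_apply, hxy _ (by push_cast; linarith [(abs_lt.1 hm).2])]
        one_le := hΛ
        nonneg := hC
        pos := by positivity
        mul_lt_one := hΛ1 }
    have key : ∀ {x y} (_ : y ∈ localUnstable x) (p : S1), D.holonomy x y p = D.graphLimit x y p :=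
      fun hxy p => D.holonomy_apply hxy p
    refine ⟨D.holonomy, fun x p => ?_, fun x y z hxy hxz p => ?_, fun x y hxy p => ?_, ?_, ?_,
      fun x y hxy p => ?_⟩
    · rw [key (D.equivalence.refl x), D.graphLimit_self]
    · have hyz := D.equivalence.trans (D.equivalence.symm hxy) hxz
      rw [key hxy, key hyz, key hxz, D.graphLimit_comp hxy hyz]
    · rw [key (D.map_rel hxy), key hxy, D.graphLimit_map hxy]
      rfl
    · exact D.continuousOn_graphLimit.congr fun q hq => key hq _
    · obtain ⟨C, γ, hγ, h⟩ := D.exists_holder_graphLimit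
      exact ⟨C, γ, hγ, fun x y hxy p q => by rw [key hxy, key hxy]; exact h x y hxy p q⟩
    · rw [key hxy]
      simpa only [graphTransform, f.fiberIter_inverse, Homeomorph.symm_symm] using
        D.tendsto_graphLimit hxy p

end Holonomies

/-! ### The bracket of two points and local product structure -/

section Bracket

variable {k : ℕ} {A : Fin k → Fin k → Prop}

open Classical in
/-- The point with the past of `x` and the future of `y`, for `x` and `y` with the same symbol at
time `0`; the value is `x` for other pairs. -/
noncomputable def bracket (x y : SFT A) : SFT A :=
  if h : x.1 0 = y.1 0 then ⟨glue (projU x, projS y), (glue_projU_projS h rfl).1⟩ else x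

theorem bracket_val {x y : SFT A} (h : x.1 0 = y.1 0) :
    (bracket x y).1 = glue (projU x, projS y) := by
  rw [bracket, dif_pos h]

theorem bracket_apply_of_nonneg {x y : SFT A} (h : x.1 0 = y.1 0) {n : ℤ} (hn : 0 ≤ n) :
    (bracket x y).1 n = y.1 n := by
  simp only [bracket_val h, glue, if_pos hn, projS, Int.toNat_of_nonneg hn]

theorem bracket_apply_of_nonpos {x y : SFT A} (h : x.1 0 = y.1 0) {n : ℤ} (hn : n ≤ 0) :
    (bracket x y).1 n = x.1 n := by
  rcases hn.eq_or_lt with rfl | hn'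
  · rw [bracket_apply_of_nonneg h le_rfl, h]
  · simp only [bracket_val h, glue, if_neg hn'.not_ge, projU,
      Int.toNat_of_nonneg (show 0 ≤ -n by omega), neg_neg]

theorem bracket_mem_localStable {x y : SFT A} (h : x.1 0 = y.1 0) :
    bracket x y ∈ localStable y := fun _ hn => bracket_apply_of_nonneg h hn

theorem bracket_mem_localUnstable {x y : SFT A} (h : x.1 0 = y.1 0) :
    bracket x y ∈ localUnstable x := fun _ hn => bracket_apply_of_nonpos h hn

theorem bracket_mem_cylinder {x y : SFT A} (h : x.1 0 = y.1 0) :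
    bracket x y ∈ cylinder A (x.1 0) := bracket_apply_of_nonpos h le_rfl

theorem bracket_eq_of_mem_localUnstable {x y : SFT A} (h : y ∈ localUnstable x) :
    bracket x y = y := by
  have h0 : x.1 0 = y.1 0 := (h 0 le_rfl).symm
  refine Subtype.ext (funext fun n => ?_)
  rcases le_total 0 n with hn | hn
  · exact bracket_apply_of_nonneg h0 hn
  · rw [bracket_apply_of_nonpos h0 hn, h n hn]

theorem bracket_eq_of_mem_localStable {b x y : SFT A} (h : b.1 0 = x.1 0)
    (hxy : y ∈ localStable x) : bracket b y = bracket b x := by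
  have h' : b.1 0 = y.1 0 := h.trans (hxy 0 le_rfl).symm
  refine Subtype.ext (funext fun n => ?_)
  rcases le_total 0 n with hn | hn
  · rw [bracket_apply_of_nonneg h hn, bracket_apply_of_nonneg h' hn, hxy n hn]
  · rw [bracket_apply_of_nonpos h hn, bracket_apply_of_nonpos h' hn]

theorem continuousOn_bracket {X : Type*} [TopologicalSpace X] {u v : X → SFT A} {s : Set X}
    (hu : ContinuousOn u s) (hv : ContinuousOn v s) (huv : ∀ q ∈ s, (u q).1 0 = (v q).1 0) :
    ContinuousOn (fun q => bracket (u q) (v q)) s := by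
  rw [Topology.IsInducing.subtypeVal.continuousOn_iff, continuousOn_pi]
  intro n
  rcases le_total 0 n with hn | hn
  · exact ((continuous_coord n).comp_continuousOn hv).congr fun q hq =>
      bracket_apply_of_nonneg (huv q hq) hn
  · exact ((continuous_coord n).comp_continuousOn hu).congr fun q hq =>
      bracket_apply_of_nonpos (huv q hq) hn

theorem measurableSet_SFT (A : Fin k → Fin k → Prop) : MeasurableSet (SFT A) := by
  have h : SFT A = ⋂ n : ℤ, (fun x : ℤ → Fin k => (x n, x (n + 1))) ⁻¹' {p | A p.1 p.2} := by
    ext x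
    simp [SFT]
  rw [h]
  exact MeasurableSet.iInter fun n =>
    ((measurable_pi_apply n).prodMk (measurable_pi_apply (n + 1))) (Set.toFinite _).measurableSet

theorem measurable_projS : Measurable (projS : SFT A → ℕ → Fin k) :=
  measurable_pi_lambda _ fun n => (continuous_coord (n : ℤ)).measurable

theorem measurable_projU : Measurable (projU : SFT A → ℕ → Fin k) :=
  measurable_pi_lambda _ fun n => (continuous_coord (-(n : ℤ))).measurable

theorem measurable_glue : Measurable (glue : (ℕ → Fin k) × (ℕ → Fin k) → ℤ → Fin k) := by
  refine measurable_pi_lambda _ fun n => ?_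
  by_cases h : 0 ≤ n
  · simp only [glue, if_pos h]
    exact (measurable_pi_apply _).comp measurable_snd
  · simp only [glue, if_neg h]
    exact (measurable_pi_apply _).comp measurable_fst

/-- Local product structure: an almost sure property holds at the bracket of almost all `x` and
almost all `y`. -/
theorem HasLocalProductStructure.ae_ae_bracket {μ : Measure (SFT A)} [IsProbabilityMeasure μ]
    (hlps : HasLocalProductStructure μ) {P : SFT A → Prop} (hP : ∀ᵐ x ∂μ, P x) :
    ∀ᵐ x ∂μ, ∀ᵐ y ∂μ, x.1 0 = y.1 0 → P (bracket x y) := by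
  obtain ⟨D, hD, hDpos, hμ⟩ := hlps
  have hval : MeasurableEmbedding (Subtype.val : SFT A → ℤ → Fin k) :=
    MeasurableEmbedding.subtype_coe (measurableSet_SFT A)
  have : IsProbabilityMeasure (μ.map (projU : SFT A → ℕ → Fin k)) :=
    Measure.isProbabilityMeasure_map measurable_projU.aemeasurable
  have : IsProbabilityMeasure (μ.map (projS : SFT A → ℕ → Fin k)) :=
    Measure.isProbabilityMeasure_map measurable_projS.aemeasurable
  have key : ∀ i : Fin k, ∀ᵐ x ∂μ, ∀ᵐ y ∂μ, x ∈ cylinder A i → y ∈ cylinder A i →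
      P (bracket x y) := by
    intro i
    set E := toMeasurable μ {x | ¬ P x} ∩ cylinder A i
    have hE : MeasurableSet E :=
      (measurableSet_toMeasurable _ _).inter (isOpen_cylinder i).measurableSet
    have hE0 : μ E = 0 := measure_mono_null Set.inter_subset_left
      ((measure_toMeasurable _).trans (ae_iff.1 hP))
    have hmeas : Measurable ((Subtype.val '' E).indicator fun z => ENNReal.ofReal (D z)) := by
      -- `D` is only known to be continuous on the subshift: extend it by zero from there
      have h1 : Measurable (E.indicator fun x : SFT A => ENNReal.ofReal (D x.1)) :=
        (ENNReal.measurable_ofReal.comp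
          (continuousOn_iff_continuous_domRestrict.1 hD).measurable).indicator hE
      have h2 := hval.measurable_extend h1 (measurable_const (a := (0 : ℝ≥0∞)))
      convert h2 using 1
      funext z
      by_cases hz : z ∈ SFT A
      · lift z to SFT A using hz
        rw [hval.injective.extend_apply]
        by_cases hzE : z ∈ E
        · rw [Set.indicator_of_mem (Set.mem_image_of_mem _ hzE), Set.indicator_of_mem hzE]
        · rw [Set.indicator_of_notMem (by simpa using hzE), Set.indicator_of_notMem hzE]
      · rw [Function.extend_apply' _ _ _ (by rintro ⟨w, rfl⟩; exact hz w.2),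
          Set.indicator_of_notMem (by rintro ⟨w, -, rfl⟩; exact hz w.2)]
    -- the density is positive, so the joins of pasts and futures avoid `E` almost surely
    have h0 := (lintegral_eq_zero_iff (hmeas.comp measurable_glue)).1
      ((hμ i E hE Set.inter_subset_right).symm.trans hE0)
    have h1 := ae_of_ae_map measurable_projU.aemeasurable
      (Measure.ae_ae_of_ae_prod (ae_imp_of_ae_restrict h0))
    filter_upwards [h1] with x hx
    filter_upwards [ae_of_ae_map measurable_projS.aemeasurable hx] with y hy hxi hyi
    have hxy : x.1 0 = y.1 0 := Eq.trans hxi (Eq.symm hyi)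
    by_contra hc
    have hmem : bracket x y ∈ E := by
      refine ⟨subset_toMeasurable _ _ hc, ?_⟩
      have h2 : (bracket x y).1 0 = x.1 0 := bracket_mem_cylinder hxy
      exact h2.trans hxi
    have h3 := hy ⟨Set.mem_image_of_mem _ hxi, Set.mem_image_of_mem _ hyi⟩
    rw [Function.comp_apply, ← bracket_val hxy,
      Set.indicator_of_mem (Set.mem_image_of_mem _ hmem)] at h3
    exact (ENNReal.ofReal_pos.2 (hDpos _ (bracket x y).2)).ne' h3
  filter_upwards [ae_all_iff.2 key] with x hx
  filter_upwards [hx (x.1 0)] with y hy hxy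
  exact hy rfl hxy.symm

end Bracket

/-! ### Invariance of the disintegration under the cocycle -/

section Disintegration

variable {k : ℕ} {A : Fin k → Fin k → Prop} {ρ α β : ℝ} {μ : Measure (SFT A)}
  {f : HolderCocycle A ρ α β}

/-- By uniqueness of disintegrations, a disintegration of an `F_f`-invariant measure is
equivariant. -/
theorem ae_kernel_shift_eq [IsProbabilityMeasure μ] (hρ : 1 < ρ) (hα : 0 < α)
    (hμ : MeasurePreserving (shift A) μ μ) {κ : Kernel (SFT A) S1} [IsMarkovKernel κ]
    (hinv : MeasurePreserving f.skew (μ ⊗ₘ κ) (μ ⊗ₘ κ)) :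
    ∀ᵐ x ∂μ, κ (shift A x) = (κ x).map (f.map x) := by
  have hmap : Measurable fun q : SFT A × S1 => f.map q.1 q.2 :=
    (f.continuous_map hρ hα).measurable
  have hη : ∀ x, ((Kernel.id ×ₖ κ).map fun q : SFT A × S1 => f.map q.1 q.2) x =
      (κ x).map (f.map x) := fun x => by
    rw [Kernel.map_apply _ hmap, Kernel.prod_apply, Kernel.id_apply, Measure.dirac_prod,
      Measure.map_map hmap measurable_prodMk_left]
    rfl
  have : IsMarkovKernel ((Kernel.id ×ₖ κ).map fun q : SFT A × S1 => f.map q.1 q.2) :=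
    Kernel.IsMarkovKernel.map _ hmap
  have h : μ ⊗ₘ (κ.comap (shift A) hμ.measurable) =
      μ ⊗ₘ ((Kernel.id ×ₖ κ).map fun q : SFT A × S1 => f.map q.1 q.2) := by
    refine Measure.ext_prod fun {s t} hs ht => ?_
    rw [Measure.compProd_apply_prod hs ht, Measure.compProd_apply_prod hs ht]
    set s' : Set (SFT A) := (shift A).symm ⁻¹' s with hs'def
    have hs' : MeasurableSet s' := continuous_shift_symm.measurable hs
    have hss' : s = shift A ⁻¹' s' := by
      ext x
      simp [hs'def]
    have h1 : ∫⁻ x in s, κ (shift A x) t ∂μ = ∫⁻ x in s', κ x t ∂μ := by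
      rw [hss']
      exact hμ.setLIntegral_comp_preimage hs' (κ.measurable_coe ht)
    have h2 : ∫⁻ x in s, (κ x).map (f.map x) t ∂μ = (μ ⊗ₘ κ) (f.skew ⁻¹' (s' ×ˢ t)) := by
      rw [Measure.compProd_apply (hinv.measurable (hs'.prod ht)), ← lintegral_indicator hs]
      refine lintegral_congr fun x => ?_
      by_cases hx : x ∈ s
      · rw [Set.indicator_of_mem hx, Measure.map_apply (f.map x).continuous.measurable ht]
        congr 1
        ext p
        simp [HolderCocycle.skew, hs'def, hx]
      · rw [Set.indicator_of_notMem hx]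
        have h3 : Prod.mk x ⁻¹' (f.skew ⁻¹' (s' ×ˢ t)) = ∅ := by
          ext p
          simp [HolderCocycle.skew, hs'def, hx]
        rw [h3, measure_empty]
    simp only [Kernel.comap_apply, hη]
    rw [h1, h2, hinv.measure_preimage (hs'.prod ht).nullMeasurableSet,
      Measure.compProd_apply_prod hs' ht]
  filter_upwards [Kernel.ae_eq_of_compProd_eq h] with x hx
  rw [← hη, ← hx, Kernel.comap_apply]

theorem ae_kernel_iterate_eq [IsProbabilityMeasure μ] (hρ : 1 < ρ) (hα : 0 < α)
    (hμ : MeasurePreserving (shift A) μ μ) {κ : Kernel (SFT A) S1} [IsMarkovKernel κ]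
    (hinv : MeasurePreserving f.skew (μ ⊗ₘ κ) (μ ⊗ₘ κ)) (n : ℕ) :
    ∀ᵐ x ∂μ, κ ((shift A)^[n] x) = (κ x).map (f.iter n x) := by
  induction n with
  | zero => exact ae_of_all _ fun x => Measure.map_id.symm
  | succ n ih =>
    filter_upwards [ih, (hμ.iterate n).quasiMeasurePreserving.ae
      (ae_kernel_shift_eq hρ hα hμ hinv)] with x hx hx'
    rw [Function.iterate_succ_apply', hx', hx, Measure.map_map
      (f.map _).continuous.measurable (f.iter n x).continuous.measurable]
    rfl

end Disintegration

/-! ### From almost all points to all points -/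

section Continuity

/-- Let the images of a measure `ν` under two continuous families of maps agree for almost all
parameters of an open set. Then they agree for all parameters in it. -/
theorem map_eq_of_ae_map_eq {X Y : Type*} [TopologicalSpace X] [FirstCountableTopology X]
    [MeasurableSpace X] [OpensMeasurableSpace X] [TopologicalSpace Y] [MeasurableSpace Y]
    [BorelSpace Y] [HasOuterApproxClosed Y] [SecondCountableTopology Y] {μ : Measure X}
    [μ.IsOpenPosMeasure] {ν : Measure Y} [IsFiniteMeasure ν] {Φ Ψ : X → Y → Y} {C : Set X}
    (hC : IsOpen C) (hΦ : ContinuousOn (fun q : X × Y => Φ q.1 q.2) (C ×ˢ Set.univ))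
    (hΨ : ContinuousOn (fun q : X × Y => Ψ q.1 q.2) (C ×ˢ Set.univ))
    (h : ∀ᵐ x ∂μ, x ∈ C → ν.map (Φ x) = ν.map (Ψ x)) {x : X} (hx : x ∈ C) :
    ν.map (Φ x) = ν.map (Ψ x) := by
  have hfib : ∀ {Θ : X → Y → Y}, ContinuousOn (fun q : X × Y => Θ q.1 q.2) (C ×ˢ Set.univ) →
      ∀ x ∈ C, Continuous (Θ x) := fun {Θ} hΘ x hx =>
    hΘ.comp_continuous (by fun_prop : Continuous fun p : Y => (x, p)) fun p => ⟨hx, trivial⟩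
  have hint : ∀ {Θ : X → Y → Y}, ContinuousOn (fun q : X × Y => Θ q.1 q.2) (C ×ˢ Set.univ) →
      ∀ φ : BoundedContinuousFunction Y ℝ, ContinuousOn (fun x => ∫ p, φ (Θ x p) ∂ν) C := by
    intro Θ hΘ φ
    refine continuousOn_of_dominated (bound := fun _ => ‖φ‖)
      (fun x hx => (φ.continuous.comp (hfib hΘ x hx)).aestronglyMeasurable)
      (fun x _ => ae_of_all _ fun p => φ.norm_coe_le_norm _) (integrable_const _)
      (ae_of_all _ fun p => ?_)
    exact φ.continuous.comp_continuousOn (hΘ.comp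
      (by fun_prop : ContinuousOn (fun x : X => (x, p)) C) fun x hx => ⟨hx, trivial⟩)
  have hmap : ∀ {Θ : X → Y → Y}, ContinuousOn (fun q : X × Y => Θ q.1 q.2) (C ×ˢ Set.univ) →
      ∀ φ : BoundedContinuousFunction Y ℝ, ∀ x ∈ C,
        ∫ p, φ p ∂(ν.map (Θ x)) = ∫ p, φ (Θ x p) ∂ν := fun {Θ} hΘ φ x hx =>
    integral_map (hfib hΘ x hx).measurable.aemeasurable φ.continuous.aestronglyMeasurable
  refine ext_of_forall_integral_eq_of_IsFiniteMeasure fun φ => ?_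
  rw [hmap hΦ φ x hx, hmap hΨ φ x hx]
  refine Measure.eqOn_open_of_ae_eq (μ := μ) ?_ hC (hint hΦ φ) (hint hΨ φ) hx
  filter_upwards [ae_restrict_of_ae h, ae_restrict_mem hC.measurableSet] with y hy hyC
  rw [← hmap hΦ φ y hyC, ← hmap hΨ φ y hyC, hy hyC]

end Continuity

/-! ### The continuous disintegration of an su-state -/

section SUState

variable {k : ℕ} {A : Fin k → Fin k → Prop} {ρ α β : ℝ} {μ : Measure (SFT A)}
  {f : HolderCocycle A ρ α β} {hs hu : SFT A → SFT A → (S1 ≃ₜ S1)}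

theorem IsStableHolonomy.comp_continuousOn (h : IsStableHolonomy f hs) {X : Type*}
    [TopologicalSpace X] {u v : X → SFT A} {p : X → S1} {s : Set X} (hu : ContinuousOn u s)
    (hv : ContinuousOn v s) (hp : ContinuousOn p s) (huv : ∀ q ∈ s, v q ∈ localStable (u q)) :
    ContinuousOn (fun q => hs (u q) (v q) (p q)) s :=
  h.continuousOn.comp ((hu.prodMk hv).prodMk hp) huv

theorem IsUnstableHolonomy.comp_continuousOn (h : IsUnstableHolonomy f hu) {X : Type*}
    [TopologicalSpace X] {u v : X → SFT A} {p : X → S1} {s : Set X} (hu' : ContinuousOn u s)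
    (hv : ContinuousOn v s) (hp : ContinuousOn p s) (huv : ∀ q ∈ s, v q ∈ localUnstable (u q)) :
    ContinuousOn (fun q => hu (u q) (v q) (p q)) s :=
  h.continuousOn.comp ((hu'.prodMk hv).prodMk hp) huv

/-- The transport from the fiber of `b` to the fiber of `x`, along the local unstable set of `b` and
then along the local stable set of `x`. -/
noncomputable def suTransport (hs hu : SFT A → SFT A → (S1 ≃ₜ S1)) (b x : SFT A) (p : S1) : S1 :=
  hs (bracket b x) x (hu b (bracket b x) p)

theorem continuousOn_suTransport (Hs : IsStableHolonomy f hs) (Hu : IsUnstableHolonomy f hu)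
    {b : SFT A} {X : Type*} [TopologicalSpace X] {u : X → SFT A} {p : X → S1} {s : Set X}
    (hu' : ContinuousOn u s) (hp : ContinuousOn p s) (hus : ∀ q ∈ s, u q ∈ cylinder A (b.1 0)) :
    ContinuousOn (fun q => suTransport hs hu b (u q) (p q)) s := by
  have hsymb : ∀ q ∈ s, b.1 0 = (u q).1 0 := fun q hq => Eq.symm (hus q hq)
  have hb := continuousOn_bracket (continuousOn_const (c := b)) hu' hsymb
  exact Hs.comp_continuousOn hb hu'
    (Hu.comp_continuousOn continuousOn_const hb hp
      fun q hq => bracket_mem_localUnstable (hsymb q hq))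
    fun q hq => equivalence_localStable.symm (bracket_mem_localStable (hsymb q hq))

theorem continuous_suTransport (Hs : IsStableHolonomy f hs) (Hu : IsUnstableHolonomy f hu)
    {b x : SFT A} (hx : x ∈ cylinder A (b.1 0)) : Continuous (suTransport hs hu b x) :=
  continuousOn_univ.1 <| continuousOn_suTransport Hs Hu continuousOn_const continuousOn_id
    fun _ _ => hx

theorem stableHolonomy_suTransport (Hs : IsStableHolonomy f hs) {b x y : SFT A}
    (hx : x ∈ cylinder A (b.1 0)) (hxy : y ∈ localStable x) (p : S1) :
    hs x y (suTransport hs hu b x p) = suTransport hs hu b y p := by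
  have hbx : b.1 0 = x.1 0 := Eq.symm hx
  have h1 := equivalence_localStable.symm (bracket_mem_localStable hbx)
  rw [suTransport, suTransport, bracket_eq_of_mem_localStable hbx hxy]
  exact Hs.comp _ _ _ h1 (equivalence_localStable.trans h1 hxy) _

theorem IsHolonomyInvariant.ae {W : SFT A → Set (SFT A)} {h : SFT A → SFT A → (S1 ≃ₜ S1)}
    {κ : Kernel (SFT A) S1} (H : IsHolonomyInvariant μ W h κ) :
    ∃ E : Set (SFT A), (∀ᵐ x ∂μ, x ∈ E) ∧
      ∀ x ∈ E, ∀ y ∈ E, y ∈ W x → κ y = (κ x).map (h x y) := by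
  obtain ⟨E, -, hE, H⟩ := H
  exact ⟨E, hE, H⟩

/-- On a cylinder, the disintegration of an su-state is almost everywhere the transport of a single
measure. -/
theorem exists_ae_eq_map_suTransport [IsProbabilityMeasure μ] [μ.IsOpenPosMeasure]
    (hlps : HasLocalProductStructure μ) {κ : Kernel (SFT A) S1}
    (hκs : IsHolonomyInvariant μ localStable hs κ)
    (hκu : IsHolonomyInvariant μ localUnstable hu κ) (x₀ : SFT A) :
    ∃ b ∈ cylinder A (x₀.1 0), ∀ᵐ x ∂μ, x ∈ cylinder A (b.1 0) →
      κ x = (κ b).map (suTransport hs hu b x) := by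
  obtain ⟨Es, hEs, hκs⟩ := hκs.ae
  obtain ⟨Eu, hEu, hκu⟩ := hκu.ae
  have hpos : ∃ᶠ x in ae μ, x ∈ cylinder A (x₀.1 0) := by
    rw [frequently_ae_mem_iff]
    exact ((isOpen_cylinder _).measure_pos μ ⟨x₀, rfl⟩).ne'
  obtain ⟨b, hb, ⟨hbs, hbu⟩, hbr⟩ :=
    (hpos.and_eventually ((hEs.and hEu).and (hlps.ae_ae_bracket (hEs.and hEu)))).exists
  refine ⟨b, hb, ?_⟩
  filter_upwards [hbr, hEs] with x hx hxs hxb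
  have hbx : b.1 0 = x.1 0 := Eq.symm hxb
  obtain ⟨h1, h2⟩ := hx hbx
  rw [hκs _ h1 _ hxs (equivalence_localStable.symm (bracket_mem_localStable hbx)),
    hκu _ hbu _ h2 (bracket_mem_localUnstable hbx),
    Measure.map_map (hs _ _).continuous.measurable (hu _ _).continuous.measurable]
  rfl

/-- The continuous version of the disintegration is invariant under unstable holonomy everywhere,
not only almost everywhere. -/
theorem map_suTransport_unstable [IsProbabilityMeasure μ] [μ.IsOpenPosMeasure]
    (hlps : HasLocalProductStructure μ) (Hs : IsStableHolonomy f hs) (Hu : IsUnstableHolonomy f hu)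
    {κ : Kernel (SFT A) S1} [IsMarkovKernel κ] (hκu : IsHolonomyInvariant μ localUnstable hu κ)
    {b : SFT A} (hb : ∀ᵐ x ∂μ, x ∈ cylinder A (b.1 0) → κ x = (κ b).map (suTransport hs hu b x))
    {x y : SFT A} (hx : x ∈ cylinder A (b.1 0)) (hxy : y ∈ localUnstable x) :
    (κ b).map (suTransport hs hu b y) =
      (κ b).map (fun p => hu x y (suTransport hs hu b x p)) := by
  obtain ⟨Eu, hEu, hκu⟩ := hκu.ae
  set C := cylinder A (b.1 0)
  have hCo : IsOpen C := isOpen_cylinder _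
  have hsymb : ∀ {u v}, u ∈ C → v ∈ C → u.1 0 = v.1 0 := fun hu hv => Eq.trans hu (Eq.symm hv)
  have hbC : ∀ {u v}, u ∈ C → v ∈ C → bracket u v ∈ C := fun {u v} hu hv =>
    Eq.trans (bracket_mem_cylinder (hsymb hu hv)) hu
  have hloc : ∀ {u v w}, u ∈ C → v ∈ C → w ∈ C → bracket u w ∈ localUnstable (bracket u v) :=
    fun hu hv hw => equivalence_localUnstable.trans
      (equivalence_localUnstable.symm (bracket_mem_localUnstable (hsymb hu hv)))
      (bracket_mem_localUnstable (hsymb hu hw))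
  -- the relation between the fibers of `bracket u v` and `bracket u w`, which have the same past
  let P : SFT A → SFT A → SFT A → Prop := fun u v w =>
    (κ b).map (fun p => suTransport hs hu b (bracket u w) p) =
      (κ b).map (fun p => hu (bracket u v) (bracket u w) (suTransport hs hu b (bracket u v) p))
  have hcont : ∀ {X : Type} [TopologicalSpace X] {u v w : X → SFT A} {p : X → S1} {s : Set X},
      ContinuousOn u s → ContinuousOn v s → ContinuousOn w s → ContinuousOn p s →
      (∀ q ∈ s, u q ∈ C) → (∀ q ∈ s, v q ∈ C) → (∀ q ∈ s, w q ∈ C) →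
      ContinuousOn (fun q => suTransport hs hu b (bracket (u q) (w q)) (p q)) s ∧
      ContinuousOn (fun q => hu (bracket (u q) (v q)) (bracket (u q) (w q))
        (suTransport hs hu b (bracket (u q) (v q)) (p q))) s := by
    intro X _ u v w p s hu' hv hw hp huC hvC hwC
    have h1 := continuousOn_bracket hu' hv fun q hq => hsymb (huC q hq) (hvC q hq)
    have h2 := continuousOn_bracket hu' hw fun q hq => hsymb (huC q hq) (hwC q hq)
    exact ⟨continuousOn_suTransport Hs Hu h2 hp fun q hq => hbC (huC q hq) (hwC q hq),
      Hu.comp_continuousOn h1 h2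
        (continuousOn_suTransport Hs Hu h1 hp fun q hq => hbC (huC q hq) (hvC q hq))
        fun q hq => hloc (huC q hq) (hvC q hq) (hwC q hq)⟩
  have hfst : ContinuousOn (Prod.fst : SFT A × S1 → SFT A) (C ×ˢ Set.univ) := continuousOn_fst
  have hsnd : ContinuousOn (Prod.snd : SFT A × S1 → S1) (C ×ˢ Set.univ) := continuousOn_snd
  have hmem : ∀ q ∈ C ×ˢ (Set.univ : Set S1), q.1 ∈ C := fun q hq => hq.1
  -- pass from almost all to all points, one of the three variables at a time
  have hP : ∀ᵐ u ∂μ, u ∈ C → ∀ᵐ v ∂μ, v ∈ C → ∀ᵐ w ∂μ, w ∈ C → P u v w := by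
    filter_upwards [hlps.ae_ae_bracket (hEu.and hb)] with u hu' huC
    filter_upwards [hu'] with v hv hvC
    filter_upwards [hu'] with w hw hwC
    obtain ⟨hv1, hv2⟩ := hv (hsymb huC hvC)
    obtain ⟨hw1, hw2⟩ := hw (hsymb huC hwC)
    have h := hκu _ hv1 _ hw1 (hloc huC hvC hwC)
    rw [hv2 (hbC huC hvC), hw2 (hbC huC hwC), Measure.map_map (hu _ _).continuous.measurable
      (continuous_suTransport Hs Hu (hbC huC hvC)).measurable] at h
    exact h
  have hP1 : ∀ᵐ u ∂μ, u ∈ C → ∀ᵐ v ∂μ, v ∈ C → ∀ w ∈ C, P u v w := by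
    filter_upwards [hP] with u hu' huC
    filter_upwards [hu' huC] with v hv hvC w hwC
    obtain ⟨h1, h2⟩ := hcont (u := fun _ => u) (v := fun _ => v) continuousOn_const
      continuousOn_const hfst hsnd (fun _ _ => huC) (fun _ _ => hvC) hmem
    exact map_eq_of_ae_map_eq (μ := μ) (Φ := fun w p => suTransport hs hu b (bracket u w) p)
      (Ψ := fun w p => hu (bracket u v) (bracket u w) (suTransport hs hu b (bracket u v) p))
      hCo h1 h2 (hv hvC) hwC
  have hP2 : ∀ᵐ u ∂μ, u ∈ C → ∀ v ∈ C, ∀ w ∈ C, P u v w := by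
    filter_upwards [hP1] with u hu' huC v hvC w hwC
    obtain ⟨h1, h2⟩ := hcont (u := fun _ => u) (w := fun _ => w) continuousOn_const
      hfst continuousOn_const hsnd (fun _ _ => huC) hmem (fun _ _ => hwC)
    refine map_eq_of_ae_map_eq (μ := μ) (Φ := fun _ p => suTransport hs hu b (bracket u w) p)
      (Ψ := fun v p => hu (bracket u v) (bracket u w) (suTransport hs hu b (bracket u v) p))
      hCo h1 h2 ?_ hvC
    filter_upwards [hu' huC] with v' hv' hvC'
    exact hv' hvC' w hwC
  have hyC : y ∈ C := Eq.trans (hxy 0 le_rfl) hx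
  have hP3 : P x x y := by
    obtain ⟨h1, h2⟩ := hcont (v := fun _ => x) (w := fun _ => y) hfst continuousOn_const
      continuousOn_const hsnd hmem (fun _ _ => hx) (fun _ _ => hyC)
    refine map_eq_of_ae_map_eq (μ := μ)
      (Φ := fun u p => suTransport hs hu b (bracket u y) p)
      (Ψ := fun u p => hu (bracket u x) (bracket u y) (suTransport hs hu b (bracket u x) p))
      hCo h1 h2 ?_ hx
    filter_upwards [hP2] with u hu' huC
    exact hu' huC x hx y hyC
  have hxx : bracket x x = x := bracket_eq_of_mem_localUnstable fun _ _ => rfl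
  simpa only [P, hxx, bracket_eq_of_mem_localUnstable hxy] using hP3

theorem continuous_iter (hρ : 1 < ρ) (hα : 0 < α) (n : ℕ) :
    Continuous fun q : SFT A × S1 => f.iter n q.1 q.2 := by
  induction n with
  | zero => exact continuous_snd
  | succ n ih =>
    exact (f.continuous_map hρ hα).comp
      (((continuous_shift.iterate n).comp continuous_fst).prodMk ih)

/-- The continuous version of the disintegration is equivariant everywhere. -/
theorem map_suTransport_iterate [IsProbabilityMeasure μ] [μ.IsOpenPosMeasure] (hρ : 1 < ρ)
    (hα : 0 < α) (Hs : IsStableHolonomy f hs) (Hu : IsUnstableHolonomy f hu)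
    {κ : Kernel (SFT A) S1} [IsMarkovKernel κ] {n : ℕ}
    (hκ : ∀ᵐ x ∂μ, κ ((shift A)^[n] x) = (κ x).map (f.iter n x))
    (hμ : MeasurePreserving (shift A) μ μ) {b : SFT A}
    (hb : ∀ᵐ x ∂μ, x ∈ cylinder A (b.1 0) → κ x = (κ b).map (suTransport hs hu b x))
    {x : SFT A} (hx : x ∈ cylinder A (b.1 0)) (hx' : (shift A)^[n] x ∈ cylinder A (b.1 0)) :
    (κ b).map (suTransport hs hu b ((shift A)^[n] x)) =
      (κ b).map (fun p => f.iter n x (suTransport hs hu b x p)) := by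
  have hn : Continuous (shift A)^[n] := continuous_shift.iterate n
  set C := cylinder A (b.1 0) ∩ (shift A)^[n] ⁻¹' cylinder A (b.1 0)
  have hCo : IsOpen C := (isOpen_cylinder _).inter ((isOpen_cylinder _).preimage hn)
  have h1 : ContinuousOn (fun q : SFT A × S1 => suTransport hs hu b ((shift A)^[n] q.1) q.2)
      (C ×ˢ Set.univ) :=
    continuousOn_suTransport Hs Hu (hn.comp continuous_fst).continuousOn continuousOn_snd
      fun q hq => hq.1.2
  have h2 : ContinuousOn (fun q : SFT A × S1 => f.iter n q.1 (suTransport hs hu b q.1 q.2))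
      (C ×ˢ Set.univ) :=
    (continuous_iter hρ hα n).comp_continuousOn (continuousOn_fst.prodMk
      (continuousOn_suTransport Hs Hu continuousOn_fst continuousOn_snd fun q hq => hq.1.1))
  refine map_eq_of_ae_map_eq (μ := μ) (Φ := fun x => suTransport hs hu b ((shift A)^[n] x))
    (Ψ := fun x p => f.iter n x (suTransport hs hu b x p)) hCo h1 h2 ?_ ⟨hx, hx'⟩
  filter_upwards [hκ, hb, (hμ.iterate n).quasiMeasurePreserving.ae hb] with y hy hyb hyb' hyC
  rw [← hyb' hyC.2, hy, hyb hyC.1, Measure.map_map (f.iter n y).continuous.measurable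
    (continuous_suTransport Hs Hu hyC.1).measurable]
  rfl

/-- The conditional measure of an su-state over a periodic point is invariant under the return map
and under the holonomy loop along a homoclinic point. -/
theorem IsSUState.exists_invariant_measure [IsProbabilityMeasure μ] [μ.IsOpenPosMeasure]
    (hρ : 1 < ρ) (hα : 0 < α) (hμ : MeasurePreserving (shift A) μ μ)
    (hlps : HasLocalProductStructure μ) (Hs : IsStableHolonomy f hs) (Hu : IsUnstableHolonomy f hu)
    {m : Measure (SFT A × S1)} (hm : IsSUState μ f hs hu m) {x₀ z : SFT A} {q N : ℕ}
    (hq : (shift A)^[q] x₀ = x₀) (hz : z ∈ localUnstable x₀)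
    (hz' : x₀ ∈ localStable ((shift A)^[N] z)) :
    ∃ ν : Measure S1, IsProbabilityMeasure ν ∧ ν.map (f.iter q x₀) = ν ∧
      ν.map (fun p => hs ((shift A)^[N] z) x₀ (f.iter N z (hu x₀ z p))) = ν := by
  obtain ⟨κ, hκ, rfl, hκs, hκu⟩ := hm.disintegration
  obtain ⟨b, hbx, hb⟩ := exists_ae_eq_map_suTransport hlps hκs hκu x₀
  have hinv := fun n => ae_kernel_iterate_eq hρ hα hμ hm.invariant n
  have hx₀ : x₀ ∈ cylinder A (b.1 0) := Eq.symm hbx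
  have hzC : z ∈ cylinder A (b.1 0) := Eq.trans (hz 0 le_rfl) hx₀
  have hzC' : (shift A)^[N] z ∈ cylinder A (b.1 0) := Eq.trans (Eq.symm (hz' 0 le_rfl)) hx₀
  have hT : ∀ {x}, x ∈ cylinder A (b.1 0) → Measurable (suTransport hs hu b x) := fun hx =>
    (continuous_suTransport Hs Hu hx).measurable
  refine ⟨(κ b).map (suTransport hs hu b x₀),
    Measure.isProbabilityMeasure_map (hT hx₀).aemeasurable, ?_, ?_⟩
  · have h := map_suTransport_iterate hρ hα Hs Hu (hinv q) hμ hb hx₀ (by rwa [hq])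
    rw [hq] at h
    rw [Measure.map_map (f.iter q x₀).continuous.measurable (hT hx₀)]
    exact h.symm
  · have h1 := map_suTransport_unstable hlps Hs Hu hκu hb hx₀ hz
    have h2 := map_suTransport_iterate hρ hα Hs Hu (hinv N) hμ hb hzC hzC'
    have mu := (hu x₀ z).continuous.measurable
    have ms := (hs ((shift A)^[N] z) x₀).continuous.measurable
    have mf := (f.iter N z).continuous.measurable
    have h1' : ((κ b).map (suTransport hs hu b x₀)).map (hu x₀ z) =
        (κ b).map (suTransport hs hu b z) := by
      rw [h1, Measure.map_map mu (hT hx₀)]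
      rfl
    have h2' : ((κ b).map (suTransport hs hu b z)).map (f.iter N z) =
        (κ b).map (suTransport hs hu b ((shift A)^[N] z)) := by
      rw [h2, Measure.map_map mf (hT hzC)]
      rfl
    have h3 : ((κ b).map (suTransport hs hu b ((shift A)^[N] z))).map
        (hs ((shift A)^[N] z) x₀) = (κ b).map (suTransport hs hu b x₀) := by
      rw [Measure.map_map ms (hT hzC')]
      exact congrArg (Measure.map · (κ b))
        (funext fun p => stableHolonomy_suTransport Hs hzC' hz' p)
    have h4 : (fun p => hs ((shift A)^[N] z) x₀ (f.iter N z (hu x₀ z p))) =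
        hs ((shift A)^[N] z) x₀ ∘ f.iter N z ∘ hu x₀ z := rfl
    rw [h4, ← Measure.map_map ms (mf.comp mu), ← Measure.map_map mf mu, h1', h2', h3]

end SUState

/-! ### Measures invariant under an attractor-repeller map -/

section AttractorRepeller

variable {φ : S1 ≃ₜ S1} {a r : S1} {ν : Measure S1} [IsProbabilityMeasure ν]

/-- An invariant measure lives on the two fixed points: the function `p ↦ d(p, a) d(p, r)` tends to
`0` along every orbit. -/
theorem IsAttractorRepeller.ae_eq_or_eq (h : IsAttractorRepeller φ a r) (hν : ν.map φ = ν) :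
    ∀ᵐ p ∂ν, p = a ∨ p = r := by
  have hpres : MeasurePreserving φ ν ν := ⟨φ.continuous.measurable, hν⟩
  let ψ : S1 → ℝ := fun p => dist p a * dist p r
  have hψ : Continuous ψ := by fun_prop
  have hψ1 : ∀ p, ‖ψ p‖ ≤ 1 := fun p => by
    rw [Real.norm_of_nonneg (by positivity)]
    exact mul_le_one₀ ((S1.dist_le_half _ _).trans (by norm_num)) dist_nonneg
      ((S1.dist_le_half _ _).trans (by norm_num))
  have hlim : ∀ p, Tendsto (fun n : ℕ => ψ (φ^[n] p)) atTop (𝓝 0) := by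
    intro p
    by_cases hp : p = r
    · have hr : ∀ n : ℕ, φ^[n] r = r := fun n =>
        Function.iterate_fixed ((h.fixed r).2 (Or.inr rfl)) n
      subst hp
      simp [ψ, hr]
    · have ha : ψ a = 0 := by simp [ψ]
      rw [← ha]
      exact (hψ.tendsto a).comp (h.attracting p hp)
  have hconst : ∀ n : ℕ, ∫ p, ψ (φ^[n] p) ∂ν = ∫ p, ψ p ∂ν := fun n => by
    rw [← integral_map (hpres.iterate n).measurable.aemeasurable hψ.aestronglyMeasurable,
      (hpres.iterate n).map_eq]
  have h0 := tendsto_integral_of_dominated_convergence (μ := ν)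
    (F := fun n p => ψ (φ^[n] p)) (fun _ => (1 : ℝ))
    (fun n => (hψ.comp (φ.continuous.iterate n)).aestronglyMeasurable) (integrable_const _)
    (fun n => ae_of_all _ fun p => hψ1 _) (ae_of_all _ hlim)
  simp only [hconst, integral_zero] at h0
  have hint : ∫ p, ψ p ∂ν = 0 := tendsto_nhds_unique tendsto_const_nhds h0
  rw [integral_eq_zero_iff_of_nonneg (fun p => by positivity)
    ((integrable_const (1 : ℝ)).mono' hψ.aestronglyMeasurable (ae_of_all _ hψ1))] at hint
  filter_upwards [hint] with p hp
  simpa [ψ] using hp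

/-- If an invariant measure of an attractor-repeller map is preserved by `H`, then `H` maps one of
the two fixed points to one of them. -/
theorem IsAttractorRepeller.exists_mem_of_map_eq (h : IsAttractorRepeller φ a r)
    (hν : ν.map φ = ν) {H : S1 → S1} (hH : Continuous H) (hHν : ν.map H = ν) :
    ∃ e ∈ ({a, r} : Set S1), H e ∈ ({a, r} : Set S1) := by
  have h1 := h.ae_eq_or_eq hν
  have h2 : ∀ᵐ p ∂ν, H p = a ∨ H p = r :=
    ae_of_ae_map hH.measurable.aemeasurable (by rwa [hHν])
  obtain ⟨p, hp, hp'⟩ := (h1.and h2).exists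
  exact ⟨p, hp, hp'⟩

end AttractorRepeller

/-! ### Breaking su-states -/

section Breaking

variable {k : ℕ} {A : Fin k → Fin k → Prop} {ρ α β : ℝ} {f g : HolderCocycle A ρ α β}

theorem iter_congr {n : ℕ} {x : SFT A}
    (h : ∀ j < n, g.map ((shift A)^[j] x) = f.map ((shift A)^[j] x)) :
    g.iter n x = f.iter n x := by
  induction n with
  | zero => rfl
  | succ n ih =>
    rw [HolderCocycle.iter, HolderCocycle.iter, h n (Nat.lt_succ_self n),
      ih fun j hj => h j (hj.trans (Nat.lt_succ_self n))]

/-- A stable holonomy only depends on the cocycle along the forward orbits. -/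
theorem IsStableHolonomy.congr {hs hs' : SFT A → SFT A → (S1 ≃ₜ S1)} (H : IsStableHolonomy f hs)
    (H' : IsStableHolonomy g hs') {x y : SFT A} (hxy : y ∈ localStable x)
    (hx : ∀ n, g.map ((shift A)^[n] x) = f.map ((shift A)^[n] x))
    (hy : ∀ n, g.map ((shift A)^[n] y) = f.map ((shift A)^[n] y)) : hs' x y = hs x y := by
  ext p
  refine tendsto_nhds_unique (H'.limit x y hxy p) ((H.limit x y hxy p).congr fun n => ?_)
  rw [iter_congr (g := g) fun j _ => hx j, iter_congr (g := g) fun j _ => hy j]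

/-- An unstable holonomy only depends on the cocycle along the strict backward orbits. -/
theorem IsUnstableHolonomy.congr {hu hu' : SFT A → SFT A → (S1 ≃ₜ S1)}
    (H : IsUnstableHolonomy f hu) (H' : IsUnstableHolonomy g hu') {x y : SFT A}
    (hxy : y ∈ localUnstable x)
    (hx : ∀ n, 0 < n → g.map ((shift A).symm^[n] x) = f.map ((shift A).symm^[n] x))
    (hy : ∀ n, 0 < n → g.map ((shift A).symm^[n] y) = f.map ((shift A).symm^[n] y)) :
    hu' x y = hu x y := by
  have key : ∀ {w : SFT A}, (∀ n, 0 < n → g.map ((shift A).symm^[n] w) =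
      f.map ((shift A).symm^[n] w)) → ∀ n, g.iter n ((shift A).symm^[n] w) =
      f.iter n ((shift A).symm^[n] w) := fun {w} hw n => iter_congr fun j hj => by
    have h : (shift A)^[j] ((shift A).symm^[n] w) = (shift A).symm^[n - j] w := by
      refine Subtype.ext (funext fun i => ?_)
      rw [shift_iterate_apply, shift_symm_iterate_apply, shift_symm_iterate_apply]
      exact congrArg w.1 (by push_cast [hj.le]; ring)
    rw [h]
    exact hw _ (Nat.sub_pos_of_lt hj)
  ext p
  refine tendsto_nhds_unique (H'.limit x y hxy p) ((H.limit x y hxy p).congr fun n => ?_)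
  rw [key hx, key hy]

theorem HolderCocycle.iter_succ_apply (f : HolderCocycle A ρ α β) (n : ℕ) (x : SFT A) (p : S1) :
    f.iter (n + 1) x p = f.iter n (shift A x) (f.map x p) := by
  rw [f.iter_eq, f.iter_eq, fiberIter_succ_apply']

theorem periodic_coord {x : SFT A} {q : ℕ} (h : (shift A)^[q] x = x) (n : ℤ) :
    x.1 (n + q) = x.1 n := by
  rw [← shift_iterate_apply, h]

/-- Rotating the fiber maps over a small neighbourhood of a homoclinic point `z` destroys all
su-states, except for finitely many angles. -/
theorem finite_setOf_admitsSUState (hρ : 1 < ρ) (hα : 0 < α) {μ : Measure (SFT A)}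
    [IsProbabilityMeasure μ] [μ.IsOpenPosMeasure] (hμ : MeasurePreserving (shift A) μ μ)
    (hlps : HasLocalProductStructure μ) {x₀ z : SFT A} {q N M : ℕ} (hq : (shift A)^[q] x₀ = x₀)
    {a r : S1} (hφ : IsAttractorRepeller (f.iter q x₀) a r)
    (hz : z ∈ localUnstable x₀) (hz' : x₀ ∈ localStable ((shift A)^[N + 1] z))
    (hM : ∀ j : ℤ, ∃ n : ℤ, n.natAbs ≤ M ∧ x₀.1 (n + j) ≠ z.1 n)
    (hM' : ∀ j : ℤ, j ≠ 0 → ∃ n : ℤ, n.natAbs ≤ M ∧ z.1 (n + j) ≠ z.1 n) :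
    {t : S1 | (f.rotateOn hρ hα z M t).AdmitsSUState μ}.Finite := by
  have hout : ∀ {x : SFT A}, (∃ n : ℤ, n.natAbs ≤ M ∧ x.1 n ≠ z.1 n) → ∀ t,
      (f.rotateOn hρ hα z M t).map x = f.map x := fun {x} ⟨n, hn, hne⟩ t =>
    rotateOn_map_of_notMem f hρ hα t fun h => hne (h n hn)
  have hx₀ : ∀ t n, (f.rotateOn hρ hα z M t).map ((shift A)^[n] x₀) =
      f.map ((shift A)^[n] x₀) := fun t n =>
    hout (by simpa only [shift_iterate_apply] using hM n) t
  have hx₀' : ∀ t n, (f.rotateOn hρ hα z M t).map ((shift A).symm^[n] x₀) =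
      f.map ((shift A).symm^[n] x₀) := fun t n =>
    hout (by simpa only [shift_symm_iterate_apply, sub_eq_add_neg] using hM (-n)) t
  have hzf : ∀ t n, 0 < n → (f.rotateOn hρ hα z M t).map ((shift A)^[n] z) =
      f.map ((shift A)^[n] z) := fun t n hn =>
    hout (by simpa only [shift_iterate_apply] using hM' n (by omega)) t
  have hzb : ∀ t n, 0 < n → (f.rotateOn hρ hα z M t).map ((shift A).symm^[n] z) =
      f.map ((shift A).symm^[n] z) := fun t n hn =>
    hout (by simpa only [shift_symm_iterate_apply, sub_eq_add_neg] using hM' (-n) (by omega)) t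
  have hzz : ∀ t, (f.rotateOn hρ hα z M t).map z = rotate t (f.map z) := fun t =>
    rotateOn_map_of_mem f hρ hα t fun _ _ => rfl
  -- the holonomy loop of the rotated cocycle maps a fixed point of the return map to another one
  have key : ∀ t, (f.rotateOn hρ hα z M t).AdmitsSUState μ → ∃ hs hu,
      IsStableHolonomy (f.rotateOn hρ hα z M t) hs ∧
      IsUnstableHolonomy (f.rotateOn hρ hα z M t) hu ∧ ∃ e ∈ ({a, r} : Set S1),
        hs ((shift A)^[N + 1] z) x₀ (f.iter N (shift A z) (f.map z (hu x₀ z e) + t)) ∈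
          ({a, r} : Set S1) := by
    rintro t ⟨hs, hu, Hs, Hu, m, hm⟩
    obtain ⟨ν, hν, hν1, hν2⟩ := hm.exists_invariant_measure hρ hα hμ hlps Hs Hu hq hz hz'
    rw [iter_congr fun j _ => hx₀ t j] at hν1
    obtain ⟨e, he, he'⟩ := hφ.exists_mem_of_map_eq hν1 ((hs _ _).continuous.comp
      (((f.rotateOn hρ hα z M t).iter (N + 1) z).continuous.comp (hu _ _).continuous)) hν2
    refine ⟨hs, hu, Hs, Hu, e, he, ?_⟩
    have h1 : (f.rotateOn hρ hα z M t).iter N (shift A z) = f.iter N (shift A z) :=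
      iter_congr fun j _ => by
        rw [← Function.iterate_succ_apply]
        exact hzf t _ j.succ_pos
    simpa only [Function.comp_apply, HolderCocycle.iter_succ_apply, h1, hzz, rotate_apply] using he'
  rcases Set.eq_empty_or_nonempty {t : S1 | (f.rotateOn hρ hα z M t).AdmitsSUState μ} with
    hemp | ⟨t₁, ht₁⟩
  · rw [hemp]
    exact Set.finite_empty
  -- the holonomies from `x₀` to `z` and from the orbit of `z` back to `x₀` do not depend on `t`
  obtain ⟨hs, hu, Hs, Hu, -⟩ := key t₁ ht₁
  have hfin : (Set.image2 (fun e e' : S1 => (f.iter N (shift A z)).symm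
      ((hs ((shift A)^[N + 1] z) x₀).symm e') - f.map z (hu x₀ z e))
      ({a, r} : Set S1) ({a, r} : Set S1)).Finite :=
    Set.Finite.image2 _ (Set.toFinite _) (Set.toFinite _)
  refine hfin.subset fun t ht => ?_
  obtain ⟨hs', hu', Hs', Hu', e, he, he'⟩ := key t ht
  have hs_eq : hs' ((shift A)^[N + 1] z) x₀ = hs ((shift A)^[N + 1] z) x₀ := by
    refine Hs.congr Hs' hz' (fun n => ?_) fun n => (hx₀ t n).trans (hx₀ t₁ n).symm
    rw [← Function.iterate_add_apply]
    exact (hzf t _ (by omega)).trans (hzf t₁ _ (by omega)).symm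
  have hu_eq : hu' x₀ z = hu x₀ z :=
    Hu.congr Hu' hz (fun n _ => (hx₀' t n).trans (hx₀' t₁ n).symm)
      fun n hn => (hzb t n hn).trans (hzb t₁ n hn).symm
  rw [hs_eq, hu_eq] at he'
  refine ⟨e, he, _, he', ?_⟩
  simp

end Breaking

theorem mainTheorem3 {k : ℕ} (A : Fin k → Fin k → Prop) (hinf : Infinite (SFT A))
    (ρ α β : ℝ) (hρ : 1 < ρ) (hα : 0 < α ∧ α ≤ 1) (hβ : 0 < β ∧ β ≤ 1)
    (μ : Measure (SFT A)) (hprob : IsProbabilityMeasure μ)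
    (herg : Ergodic (shift A) μ) (hsupp : μ.IsOpenPosMeasure)
    (hlps : HasLocalProductStructure μ)
    (f : HolderCocycle A ρ α β) (hpinch : f.IsPinching) (hdom : f.IsSUDominated)
    (ε : ℝ) (hε : 0 < ε) :
    ∃ g : HolderCocycle A ρ α β, dAlpha f g < ε ∧
      (β = 1 → g.HasHolonomies) ∧ ¬ g.AdmitsSUState μ := by
  obtain ⟨x₀, hper, a, r, hφ⟩ := hpinch
  set q := Function.minimalPeriod (shift A) x₀
  have hq0 : 0 < q := Function.minimalPeriod_pos_of_mem_periodicPts hper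
  have hq : (shift A)^[q] x₀ = x₀ := Function.iterate_minimalPeriod
  obtain ⟨z, N, hu, hs, hz⟩ := exists_homoclinic hinf herg hq0 (periodic_coord hq)
  -- for `N = 0` the point `z` would be `x₀`
  have hN : N ≠ 0 := by
    rintro rfl
    obtain ⟨n, hn⟩ := hz 0
    refine hn ?_
    rw [add_zero]
    rcases le_total n 0 with h | h
    · exact (hu n h).symm
    · simpa using (hs n h).symm
  obtain ⟨N, rfl⟩ := Nat.exists_eq_succ_of_ne_zero hN
  obtain ⟨M, hM, hM'⟩ := exists_isolating_window hq0 (periodic_coord hq) hu hs hz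
  have hfin := finite_setOf_admitsSUState hρ hα.1 herg.toMeasurePreserving hlps hq hφ
    (z := z) (N := N) (M := M) hu
    (fun n hn => by rw [shift_iterate_apply]; exact (hs n hn).symm) hM hM'
  have : Nontrivial S1 := ⟨a, r, hφ.ne⟩
  obtain ⟨t, ht, ht'⟩ := ((infinite_of_mem_nhds (0 : S1)
    (eventually_dAlpha_rotateOn_lt hdom hρ hα.1 hβ.1 z M hε)).sdiff hfin).nonempty
  refine ⟨f.rotateOn hρ hα.1 z M t, ht, ?_, ht'⟩
  rintro rfl
  exact (hdom.rotateOn hρ hα.1 z M t).hasHolonomies hρ hα.1
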